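/- **Conventions.** All spaces are finite-dimensional, $A=\mathbb C^{d_A}$, $B=\mathbb C^{d_B}$ with $d_A,d_B\ge 1$. A quantum operation is a completely positive linear map. An operation $\mathcal E$ on $AB$ is *separable* if $\mathcal E(\rho)=\sum_j (A_j\otimes B_j)\rho(A_j\otimes B_j)^\dagger$ (finite sum) for some operators $A_j,B_j$; a state is separable if it is a convex combination of product states. For trace-preserving operations $\mathcal E,\mathcal F$ on $AB$, $R(\mathcal E\|\mathcal F)\in[0,\infty]$ is the least $t\ge0$ such that $\frac1{1+t}\mathcal E+\frac t{1+t}\mathcal F$ is separable ($\infty$ if there is none). The global robustness $R_g(\mathcal E)$ and the separable robustness $R_s(\mathcal E)$ are the minima of $R(\mathcal E\|\mathcal F)$ over all trace-preserving $\mathcal F$, respectively over all separable trace-preserving $\mathcal F$. For bipartite states, $R(\rho\|\sigma)$ is the least $t\ge 0$ such that $\frac1{1+t}\rho+\frac t{1+t}\sigma$ is separable, and $R(\rho)$ is its minimum over separable $\sigma$. A unitary $U$ is identified with the operation $\mathcal U(\rho)=U\rho U^\dagger$, and $\rho(U)$ is the state of $R_AA:BR_B$ obtained by applying $U$ to $AB$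 in the state $|\alpha\rangle|\beta\rangle$, where $|\alpha\rangle=\sum_j|jj\rangle/\sqrt{d_A}$ on $R_AA$ and $|\beta\rangle=\sum_j|jj\rangle/\sqrt{d_B}$ on $BR_B$ are maximally entangled. **Theorem.** Let $U$ be a unitary on $AB$ with an operator-Schmidt decomposition $U=\sum_j u_jA_j\otimes B_j$ (that is, $u_j\ge0$, $\operatorname{tr}(A_j^\dagger A_k)=\operatorname{tr}(B_j^\dagger B_k)=\delta_{jk}$) in which $A_jA_j^\dagger=I/d_A$ and $B_jB_j^\dagger=I/d_B$ for all $j$, so that all $A_j$, $B_j$ are proportional to unitaries. Then $$R_g(U)=R_s(U)=R(\rho(U))=\frac{\big(\sum_j u_j\big)^2}{d_Ad_B}-1,$$ and in all three cases the minimum is attained. Suppose moreover that $\sum_{k\ne l}u_ku_l\neq0$ (i.e. $U$ is not a product $V\otimes W$). Then the quantum operation $$\mathcal F(\rho)=\frac{d_Ad_B}{\sum_{k\ne l}u_ku_l}\sum_{k\neq l}u_ku_l\,(A_k\otimes B_l)\,\rho\,(A_k\otimes B_l)^\dagger$$ is trace-preserving and separable, can be implemented by local operations and classical communication, and is noise against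 which $U$ is least robust: $\mathcal U+R(\rho(U))\,\mathcal F$ is separable and $R(U\|\mathcal F)=R_g(U)$. **Example.** $R_g(\mathrm{CNOT})=R_s(\mathrm{CNOT})=1$. The CNOT gate has an operator-Schmidt decomposition as in the theorem with $\sum_{k\ne l}u_ku_l\ne0$ such that, with the corresponding $\mathcal F$, for every $p\in[1/2,1]$ the noisy gate $(1-p)\,\mathrm{CNOT}+p\,\mathcal F$ is separable, and every circuit on any number of qubits that starts in a computational basis state and consists of arbitrary one-qubit trace-preserving operations and this noisy gate only produces fully separable states. Consequently $p_{\rm th}\le 1/2$, where $p_{\rm th}$ is the supremum of the $p\in[0,1]$ such that, whatever the noise $\mathcal E$ from the allowed class, some such circuit with the noisy gate $(1-p)\,\mathrm{CNOT}+p\,\mathcal E$ in place of $\mathrm{CNOT}$ produces a state that is not fully separable; this holds both when $\mathcal E$ ranges over all trace-preserving operations and when it ranges over the separable trace-preserving ones. -/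

import Mathlib

open scoped Matrix Kronecker ENNReal ComplexOrder

noncomputable section

/-- Operators on the bipartite space `ℂ^a ⊗ ℂ^b`. -/
abbrev BiOp (a b : ℕ) : Type := Matrix (Fin a × Fin b) (Fin a × Fin b) ℂ

/-! ### States -/

/-- Density operators. -/
def IsDensity {ι : Type} [Fintype ι] (ρ : Matrix ι ι ℂ) : Prop :=
  ρ.PosSemidef ∧ ρ.trace = 1

/-- Separability of a bipartite state with respect to the cut `ι : κ`: it is a convex combination
of product states. -/
def IsSeparableState {ι κ : Type} [Fintype ι] [Fintype κ]
    (σ : Matrix (ι × κ) (ι × κ) ℂ) : Prop :=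
  ∃ (m : ℕ) (p : Fin m → ℝ) (ρ₁ : Fin m → Matrix ι ι ℂ) (ρ₂ : Fin m → Matrix κ κ ℂ),
    (∀ j, 0 ≤ p j) ∧ ∑ j, p j = 1 ∧ (∀ j, IsDensity (ρ₁ j)) ∧ (∀ j, IsDensity (ρ₂ j)) ∧
      σ = ∑ j, (p j : ℂ) • (ρ₁ j ⊗ₖ ρ₂ j)

/-- The non-negative `t` for which `(ρ + t σ) / (1 + t)` is a separable state. -/
def stateMixing {ι κ : Type} [Fintype ι] [Fintype κ]
    (ρ σ : Matrix (ι × κ) (ι × κ) ℂ) : Set ℝ :=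
  {t | 0 ≤ t ∧ IsSeparableState (((1 / (1 + t) : ℝ) : ℂ) • ρ + ((t / (1 + t) : ℝ) : ℂ) • σ)}

/-- The robustness `R(ρ‖σ)` of `ρ` relative to `σ`; it is `∞` if no `t` works. -/
def stateRelRobustness {ι κ : Type} [Fintype ι] [Fintype κ]
    (ρ σ : Matrix (ι × κ) (ι × κ) ℂ) : ℝ≥0∞ :=
  sInf (ENNReal.ofReal '' stateMixing ρ σ)

/-- The robustness `R(ρ)`: the least `R(ρ‖σ)` over all separable states `σ`. -/
def stateRobustness {ι κ : Type} [Fintype ι] [Fintype κ]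
    (ρ : Matrix (ι × κ) (ι × κ) ℂ) : ℝ≥0∞ :=
  sInf {x | ∃ σ, IsSeparableState σ ∧ x = stateRelRobustness ρ σ}

/-! ### Quantum operations -/

/-- The map `X ↦ K X K†`. -/
def conjOp {ι κ : Type} [Fintype ι] (K : Matrix κ ι ℂ) :
    Matrix ι ι ℂ →ₗ[ℂ] Matrix κ κ ℂ where
  toFun X := K * X * Kᴴ
  map_add' X Y := by rw [Matrix.mul_add, Matrix.add_mul]
  map_smul' c X := by simp

/-- `id_k ⊗ E`. -/
def ampliate {ι κ : Type} (k : ℕ) (E : Matrix ι ι ℂ →ₗ[ℂ] Matrix κ κ ℂ)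
    (X : Matrix (Fin k × ι) (Fin k × ι) ℂ) : Matrix (Fin k × κ) (Fin k × κ) ℂ :=
  Matrix.of fun p q => E (Matrix.of fun a b => X (p.1, a) (q.1, b)) p.2 q.2

/-- Complete positivity. -/
def IsCompletelyPositive {ι κ : Type} (E : Matrix ι ι ℂ →ₗ[ℂ] Matrix κ κ ℂ) : Prop :=
  ∀ (k : ℕ) (X : Matrix (Fin k × ι) (Fin k × ι) ℂ), X.PosSemidef → (ampliate k E X).PosSemidef

/-- Trace-preserving quantum operations. -/
def IsChannel {ι κ : Type} [Fintype ι] [Fintype κ]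
    (E : Matrix ι ι ℂ →ₗ[ℂ] Matrix κ κ ℂ) : Prop :=
  IsCompletelyPositive E ∧ ∀ X, (E X).trace = X.trace

/-- Separable quantum operations: there is an operator-sum representation with product
operators. -/
def IsSeparableOp {a b : ℕ} (E : BiOp a b →ₗ[ℂ] BiOp a b) : Prop :=
  ∃ (m : ℕ) (A : Fin m → Matrix (Fin a) (Fin a) ℂ) (B : Fin m → Matrix (Fin b) (Fin b) ℂ),
    E = ∑ j, conjOp (A j ⊗ₖ B j)

/-- Operations that can be implemented by local operations and classical communication in finitely
many rounds. In a round one party performs a generalised measurement with Kraus operators `K i`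
(possibly changing the dimension of the local system, so that local ancillas may be added or
discarded), and announces the outcome `i`; the rest of the protocol may depend on `i`. -/
inductive IsLOCC : {a b a' b' : ℕ} → (BiOp a b →ₗ[ℂ] BiOp a' b') → Prop
  | done (a b : ℕ) : IsLOCC (LinearMap.id : BiOp a b →ₗ[ℂ] BiOp a b)
  | alice {a b a' b' m : ℕ} (c : Fin m → ℕ) (K : (i : Fin m) → Matrix (Fin (c i)) (Fin a) ℂ)
      (hK : ∑ i, (K i)ᴴ * K i = 1) (Φ : (i : Fin m) → BiOp (c i) b →ₗ[ℂ] BiOp a' b')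
      (hΦ : ∀ i, IsLOCC (Φ i)) :
      IsLOCC (∑ i, Φ i ∘ₗ conjOp (K i ⊗ₖ (1 : Matrix (Fin b) (Fin b) ℂ)))
  | bob {a b a' b' m : ℕ} (c : Fin m → ℕ) (K : (i : Fin m) → Matrix (Fin (c i)) (Fin b) ℂ)
      (hK : ∑ i, (K i)ᴴ * K i = 1) (Φ : (i : Fin m) → BiOp a (c i) →ₗ[ℂ] BiOp a' b')
      (hΦ : ∀ i, IsLOCC (Φ i)) :
      IsLOCC (∑ i, Φ i ∘ₗ conjOp ((1 : Matrix (Fin a) (Fin a) ℂ) ⊗ₖ K i))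

/-! ### Robustness of quantum gates -/

/-- The non-negative `t` for which `(E + t F) / (1 + t)` is a separable operation. -/
def gateMixing {a b : ℕ} (E F : BiOp a b →ₗ[ℂ] BiOp a b) : Set ℝ :=
  {t | 0 ≤ t ∧ IsSeparableOp (((1 / (1 + t) : ℝ) : ℂ) • E + ((t / (1 + t) : ℝ) : ℂ) • F)}

/-- The robustness `R(E‖F)` of `E` relative to `F`; it is `∞` if no `t` works. -/
def gateRelRobustness {a b : ℕ} (E F : BiOp a b →ₗ[ℂ] BiOp a b) : ℝ≥0∞ :=
  sInf (ENNReal.ofReal '' gateMixing E F)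

/-- The global robustness `R_g(E)`: the least `R(E‖F)` over all trace-preserving `F`. -/
def globalRobustness {a b : ℕ} (E : BiOp a b →ₗ[ℂ] BiOp a b) : ℝ≥0∞ :=
  sInf {x | ∃ F, IsChannel F ∧ x = gateRelRobustness E F}

/-- The separable robustness `R_s(E)`: the least `R(E‖F)` over all separable, trace-preserving
`F`. -/
def separableRobustness {a b : ℕ} (E : BiOp a b →ₗ[ℂ] BiOp a b) : ℝ≥0∞ :=
  sInf {x | ∃ F, IsChannel F ∧ IsSeparableOp F ∧ x = gateRelRobustness E F}

/-- The maximally entangled unit vector `∑ j, |j j⟩ / √d`. -/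
def maxEntangled (d : ℕ) : Fin d × Fin d → ℂ :=
  fun p => if p.1 = p.2 then ((1 / Real.sqrt d : ℝ) : ℂ) else 0

/-- `id_{R_A} ⊗ E ⊗ id_{R_B}` acting on operators of `(R_A A)(B R_B)`. -/
def actMiddle {a b : ℕ} (E : BiOp a b →ₗ[ℂ] BiOp a b)
    (X : Matrix ((Fin a × Fin a) × (Fin b × Fin b)) ((Fin a × Fin a) × (Fin b × Fin b)) ℂ) :
    Matrix ((Fin a × Fin a) × (Fin b × Fin b)) ((Fin a × Fin a) × (Fin b × Fin b)) ℂ :=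
  Matrix.of fun p q =>
    E (Matrix.of fun s t => X ((p.1.1, s.1), (s.2, p.2.2)) ((q.1.1, t.1), (t.2, q.2.2)))
      (p.1.2, p.2.1) (q.1.2, q.2.1)

/-- The state `ρ(E)` that results when `E` acts on `|α⟩|β⟩`, with `|α⟩` and `|β⟩` the maximally
entangled states of `R_A A` and of `B R_B`. -/
def gateState {a b : ℕ} (E : BiOp a b →ₗ[ℂ] BiOp a b) :
    Matrix ((Fin a × Fin a) × (Fin b × Fin b)) ((Fin a × Fin a) × (Fin b × Fin b)) ℂ :=
  actMiddle E (Matrix.vecMulVec (maxEntangled a) (star (maxEntangled a)) ⊗ₖ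
    Matrix.vecMulVec (maxEntangled b) (star (maxEntangled b)))

/-! ### Operator-Schmidt decompositions -/

/-- `U = ∑ j, u j • A j ⊗ B j` is an operator-Schmidt decomposition: `u j ≥ 0` and the families
`A` and `B` are orthonormal for the Hilbert-Schmidt inner product. -/
structure IsOperatorSchmidt {a b r : ℕ} (U : BiOp a b) (u : Fin r → ℝ)
    (A : Fin r → Matrix (Fin a) (Fin a) ℂ) (B : Fin r → Matrix (Fin b) (Fin b) ℂ) : Prop where
  nonneg : ∀ j, 0 ≤ u j
  orthonormal_left : ∀ j k, ((A j)ᴴ * A k).trace = if j = k then 1 else 0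
  orthonormal_right : ∀ j k, ((B j)ᴴ * B k).trace = if j = k then 1 else 0
  decomp : U = ∑ j, (u j : ℂ) • (A j ⊗ₖ B j)

/-- An operator-Schmidt decomposition all of whose operators are proportional to unitaries. -/
structure IsUnitarySchmidt {a b r : ℕ} (U : BiOp a b) (u : Fin r → ℝ)
    (A : Fin r → Matrix (Fin a) (Fin a) ℂ) (B : Fin r → Matrix (Fin b) (Fin b) ℂ) : Prop extends
    IsOperatorSchmidt U u A B where
  unitary_left : ∀ j, A j * (A j)ᴴ = (a : ℂ)⁻¹ • (1 : Matrix (Fin a) (Fin a) ℂ)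
  unitary_right : ∀ j, B j * (B j)ᴴ = (b : ℂ)⁻¹ • (1 : Matrix (Fin b) (Fin b) ℂ)

/-- `∑_{k ≠ l} u_k u_l`. -/
def offDiagSum {r : ℕ} (u : Fin r → ℝ) : ℝ :=
  ∑ q ∈ (Finset.univ : Finset (Fin r)).offDiag, u q.1 * u q.2

/-- The noise operation `F(ρ) = (d_A d_B / ∑_{k≠l} u_k u_l) ∑_{k≠l} u_k u_l (A_k⊗B_l) ρ (A_k⊗B_l)†`.
The factor `d_A d_B` compensates for the normalisation `tr (A_k† A_k) = tr (B_l† B_l) = 1`. -/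
def worstNoise {a b r : ℕ} (u : Fin r → ℝ)
    (A : Fin r → Matrix (Fin a) (Fin a) ℂ) (B : Fin r → Matrix (Fin b) (Fin b) ℂ) :
    BiOp a b →ₗ[ℂ] BiOp a b :=
  (((a : ℝ) * b / offDiagSum u : ℝ) : ℂ) •
    ∑ q ∈ (Finset.univ : Finset (Fin r)).offDiag,
      ((u q.1 * u q.2 : ℝ) : ℂ) • conjOp (A q.1 ⊗ₖ B q.2)

/-! ### Noisy circuits on qubits -/

/-- The controlled-NOT gate `|x, y⟩ ↦ |x, x + y⟩`. -/
def cnot : BiOp 2 2 :=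
  Matrix.of fun p q => if p.1 = q.1 ∧ p.2 = q.1 + q.2 then 1 else 0

/-- With probability `p` the operation `F` occurs instead of the gate `U`. -/
def noisyGate {a b : ℕ} (U : BiOp a b) (F : BiOp a b →ₗ[ℂ] BiOp a b) (p : ℝ) :
    BiOp a b →ₗ[ℂ] BiOp a b :=
  ((1 - p : ℝ) : ℂ) • conjOp U + (p : ℂ) • F

/-- Operators on `n` qubits. -/
abbrev QubitOp (n : ℕ) : Type := Matrix (Fin n → Fin 2) (Fin n → Fin 2) ℂ

/-- A one-qubit operation applied to qubit `i` of `n` qubits. -/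
def applyOne {n : ℕ} (E : Matrix (Fin 2) (Fin 2) ℂ →ₗ[ℂ] Matrix (Fin 2) (Fin 2) ℂ) (i : Fin n)
    (ρ : QubitOp n) : QubitOp n :=
  Matrix.of fun x y =>
    E (Matrix.of fun s t => ρ (Function.update x i s) (Function.update y i t)) (x i) (y i)

/-- A two-qubit operation applied to the qubits `i ≠ j` of `n` qubits. -/
def applyTwo {n : ℕ} (E : BiOp 2 2 →ₗ[ℂ] BiOp 2 2) (i j : Fin n)
    (ρ : QubitOp n) : QubitOp n :=
  Matrix.of fun x y =>
    E (Matrix.of fun s t => ρ (Function.update (Function.update x i s.1) j s.2)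
      (Function.update (Function.update y i t.1) j t.2)) (x i, x j) (y i, y j)

/-- States of an `n`-qubit computer that is prepared in a computational basis state and can apply
arbitrary one-qubit trace-preserving operations and the two-qubit gate `G` to any qubits. -/
inductive Reachable (G : BiOp 2 2 →ₗ[ℂ] BiOp 2 2) {n : ℕ} : QubitOp n → Prop
  | init (x : Fin n → Fin 2) : Reachable G (Matrix.single x x 1)
  | one (i : Fin n) (E : Matrix (Fin 2) (Fin 2) ℂ →ₗ[ℂ] Matrix (Fin 2) (Fin 2) ℂ)
      (hE : IsChannel E) (ρ : QubitOp n) (hρ : Reachable G ρ) : Reachable G (applyOne E i ρ)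
  | two (i j : Fin n) (hij : i ≠ j) (ρ : QubitOp n) (hρ : Reachable G ρ) :
      Reachable G (applyTwo G i j ρ)

/-- Convex combinations of states `σ₁ ⊗ ⋯ ⊗ σₙ` of `n` qubits. -/
def IsFullySeparable {n : ℕ} (ρ : QubitOp n) : Prop :=
  ∃ (m : ℕ) (p : Fin m → ℝ) (σ : Fin m → Fin n → Matrix (Fin 2) (Fin 2) ℂ),
    (∀ k, 0 ≤ p k) ∧ ∑ k, p k = 1 ∧ (∀ k i, IsDensity (σ k i)) ∧
      ρ = ∑ k, (p k : ℂ) • Matrix.of fun x y => ∏ i, σ k i (x i) (y i)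

/-- Circuits of one-qubit operations and the gate `G` can produce entanglement. -/
def CanEntangle (G : BiOp 2 2 →ₗ[ℂ] BiOp 2 2) : Prop :=
  ∃ (n : ℕ) (ρ : QubitOp n), Reachable G ρ ∧ ¬ IsFullySeparable ρ

/-- The noise threshold of the gate `U` against an adversary who picks the noise from the class
`𝒩`: the supremum of the error probabilities `p` such that, whatever the noise, circuits using
the noisy gate can still produce entanglement. -/
def noiseThreshold (U : BiOp 2 2) (𝒩 : Set (BiOp 2 2 →ₗ[ℂ] BiOp 2 2)) : ℝ :=
  sSup {p | p ∈ Set.Icc (0 : ℝ) 1 ∧ ∀ F ∈ 𝒩, CanEntangle (noisyGate U F p)}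

end

/-! ### Separable operations and complete positivity -/

/-! Upper bound. Give the Kraus operator `(∑ √u_j φ_j A_j) ⊗ (∑ √u_k φ̄_k B_k)` random phases `φ`.
The matched pairs `j = k` carry no phase and add up coherently to `U`. After averaging, every
mismatched pair `k ≠ l` survives only incoherently, as `u_k u_l (A_k ⊗ B_l) · (A_k ⊗ B_l)†`. So `U`
plus these terms is separable (`isSeparableOp_phase_average`). Since `A_k ⊗ B_l` is `1/√(d_A d_B)`
times a unitary, the added terms are a multiple of a trace-preserving mixture of local unitaries, of
weight `∑_{k≠l} u_k u_l / (d_A d_B)`. Unitarity of `U` gives `∑ u_j² = d_A d_B`, which turns this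
weight into `(∑ u_j)² / (d_A d_B) - 1`.

Lower bound. Acting on halves of maximally entangled states sends separable operations to separable
states, so a mixture that makes the gate separable also makes `ρ(U)` separable. This state is pure,
with Schmidt coefficients `u_j / √(d_A d_B)` and Schmidt vectors `x_j`, `y_j` given by the entries
of `A_j`, `B_j`. The unnormalised vector `w = ∑ x_j ⊗ y_j` is a witness: `⟨w|σ|w⟩ ≤ 1` for separable
`σ` (`tensorVec_separable_le`), whereas `ρ(U)` gives `(∑ u_j)² / (d_A d_B)`. The noise contributes a
nonnegative amount, so `1 + t` is at least this value. Only positivity of the noise enters, hence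
one bound serves all three robustnesses.

Circuits. A separable trace-preserving gate preserves full separability. For CNOT the robustness is
`1`, so noise of probability `1/2` already suffices. -/

theorem conjOp_apply {ι κ : Type} [Fintype ι] (K : Matrix κ ι ℂ) (X : Matrix ι ι ℂ) :
    conjOp K X = K * X * Kᴴ := rfl

theorem conjOp_smul {ι κ : Type} [Fintype ι] (c : ℂ) (K : Matrix κ ι ℂ) :
    conjOp (c • K) = (c * star c) • conjOp K := by
  ext1 X
  simp [conjOp_apply, smul_smul, mul_comm]

theorem conjOp_sum {ι κ τ : Type} [Fintype ι] [Fintype τ] (w : τ → ℂ)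
    (M : τ → Matrix κ ι ℂ) (X : Matrix ι ι ℂ) :
    conjOp (∑ q, w q • M q) X =
      ∑ q, ∑ q', (w q * star (w q')) • (M q * X * (M q')ᴴ) := by
  simp only [conjOp_apply, Matrix.conjTranspose_sum, Matrix.sum_mul, Matrix.mul_sum,
    Matrix.conjTranspose_smul, Matrix.smul_mul, Matrix.mul_smul, Finset.smul_sum, smul_smul]
  rw [Finset.sum_comm]
  simp only [mul_comm]

theorem isSeparableOp_sum {a b : ℕ} {τ : Type} [Fintype τ] (A : τ → Matrix (Fin a) (Fin a) ℂ)
    (B : τ → Matrix (Fin b) (Fin b) ℂ) : IsSeparableOp (∑ j, conjOp (A j ⊗ₖ B j)) := by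
  refine ⟨Fintype.card τ, fun j => A ((Fintype.equivFin τ).symm j),
    fun j => B ((Fintype.equivFin τ).symm j), ?_⟩
  exact ((Fintype.equivFin τ).symm.sum_comp fun j => conjOp (A j ⊗ₖ B j)).symm

theorem isSeparableOp_kronecker {a b : ℕ} (A : Matrix (Fin a) (Fin a) ℂ)
    (B : Matrix (Fin b) (Fin b) ℂ) : IsSeparableOp (conjOp (A ⊗ₖ B)) :=
  ⟨1, fun _ => A, fun _ => B, by simp⟩

theorem IsSeparableOp.add {a b : ℕ} {E F : BiOp a b →ₗ[ℂ] BiOp a b} (hE : IsSeparableOp E)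
    (hF : IsSeparableOp F) : IsSeparableOp (E + F) := by
  obtain ⟨m, A, B, rfl⟩ := hE
  obtain ⟨n, A', B', rfl⟩ := hF
  have h := isSeparableOp_sum (τ := Fin m ⊕ Fin n) (Sum.elim A A') (Sum.elim B B')
  rwa [Fintype.sum_sum_type] at h

theorem IsSeparableOp.smul {a b : ℕ} {E : BiOp a b →ₗ[ℂ] BiOp a b} (hE : IsSeparableOp E)
    {c : ℝ} (hc : 0 ≤ c) : IsSeparableOp ((c : ℂ) • E) := by
  obtain ⟨m, A, B, rfl⟩ := hE
  refine ⟨m, fun j => ((Real.sqrt c : ℝ) : ℂ) • A j, B, ?_⟩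
  rw [Finset.smul_sum]
  refine Finset.sum_congr rfl fun j _ => ?_
  rw [Matrix.smul_kronecker, conjOp_smul]
  congr 1
  rw [Complex.star_def, Complex.conj_ofReal, ← Complex.ofReal_mul, Real.mul_self_sqrt hc]

theorem isSeparableOp_finset_sum {a b : ℕ} {τ : Type} (s : Finset τ)
    (E : τ → BiOp a b →ₗ[ℂ] BiOp a b) (hE : ∀ j ∈ s, IsSeparableOp (E j)) :
    IsSeparableOp (∑ j ∈ s, E j) := by
  classical
  induction s using Finset.induction_on with
  | empty => exact ⟨0, fun _ => 0, fun _ => 0, by simp⟩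
  | insert j s hj ih =>
    rw [Finset.sum_insert hj]
    exact (hE j (by simp)).add (ih fun k hk => hE k (by simp [hk]))

theorem ampliate_conjOp {ι κ : Type} [Fintype ι] (k : ℕ) (K : Matrix κ ι ℂ)
    (X : Matrix (Fin k × ι) (Fin k × ι) ℂ) :
    ampliate k (conjOp K) X =
      ((1 : Matrix (Fin k) (Fin k) ℂ) ⊗ₖ K) * X * ((1 : Matrix (Fin k) (Fin k) ℂ) ⊗ₖ K)ᴴ := by
  ext p q
  simp only [ampliate, conjOp_apply, Matrix.of_apply, Matrix.mul_apply, Fintype.sum_prod_type,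
    Matrix.kroneckerMap_apply, Matrix.one_apply, Matrix.conjTranspose_apply, ite_mul, one_mul,
    zero_mul, apply_ite star, star_zero, mul_ite, mul_zero]
  simp

theorem isCompletelyPositive_conjOp {ι κ : Type} [Fintype ι] [Fintype κ] (K : Matrix κ ι ℂ) :
    IsCompletelyPositive (conjOp K) := by
  intro k X hX
  rw [ampliate_conjOp]
  exact hX.mul_mul_conjTranspose_same _

theorem IsCompletelyPositive.smul {ι κ : Type} {E : Matrix ι ι ℂ →ₗ[ℂ] Matrix κ κ ℂ}
    (hE : IsCompletelyPositive E) {c : ℝ} (hc : 0 ≤ c) : IsCompletelyPositive ((c : ℂ) • E) := by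
  intro k X hX
  exact (hE k X hX).smul (a := (c : ℂ)) (by exact_mod_cast hc)

theorem isCompletelyPositive_finset_sum {ι κ τ : Type} (s : Finset τ)
    (E : τ → Matrix ι ι ℂ →ₗ[ℂ] Matrix κ κ ℂ) (hE : ∀ j ∈ s, IsCompletelyPositive (E j)) :
    IsCompletelyPositive (∑ j ∈ s, E j) := by
  intro k X hX
  have h : ampliate k (∑ j ∈ s, E j) X = ∑ j ∈ s, ampliate k (E j) X := by
    ext p q
    simp [ampliate, Matrix.sum_apply]
  rw [h]
  exact Matrix.posSemidef_sum s fun j hj => hE j hj k X hX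

theorem IsSeparableOp.isCompletelyPositive {a b : ℕ} {E : BiOp a b →ₗ[ℂ] BiOp a b}
    (hE : IsSeparableOp E) : IsCompletelyPositive E := by
  obtain ⟨m, A, B, rfl⟩ := hE
  exact isCompletelyPositive_finset_sum _ _ fun j _ => isCompletelyPositive_conjOp _

theorem trace_conjOp_of_conjTranspose_mul {ι : Type} [Fintype ι] [DecidableEq ι]
    {K : Matrix ι ι ℂ} {c : ℂ} (hK : Kᴴ * K = c • 1) (X : Matrix ι ι ℂ) :
    (conjOp K X).trace = c * X.trace := by
  rw [conjOp_apply, Matrix.mul_assoc, Matrix.trace_mul_comm, Matrix.mul_assoc, hK]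
  simp

theorem isChannel_conjOp {ι : Type} [Fintype ι] [DecidableEq ι] {U : Matrix ι ι ℂ}
    (hU : U ∈ Matrix.unitaryGroup ι ℂ) : IsChannel (conjOp U) := by
  refine ⟨isCompletelyPositive_conjOp U, fun X => ?_⟩
  rw [trace_conjOp_of_conjTranspose_mul (c := 1), one_mul]
  rw [one_smul]
  exact Matrix.mem_unitaryGroup_iff'.1 hU

/-! ### The phase-averaged separable operation -/

/-- The phases must tell `e_j - e_k` from `e_k - e_j`. This needs `1 ≠ -1`, which is why the
exponents live in `ZMod 3` and not in `ZMod 2`. -/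
theorem pi_single_sub_eq_iff {r : ℕ} (q q' : Fin r × Fin r) :
    (Pi.single q.1 (1 : ZMod 3) - Pi.single q.2 1 : Fin r → ZMod 3) =
        Pi.single q'.1 1 - Pi.single q'.2 1 ↔
      q = q' ∨ (q.1 = q.2 ∧ q'.1 = q'.2) := by
  obtain ⟨j, k⟩ := q
  obtain ⟨j', k'⟩ := q'
  constructor
  · intro h
    simp only [Prod.mk.injEq]
    by_contra hne
    have h1 := congrFun h j
    have h2 := congrFun h k
    have h3 := congrFun h j'
    have h4 := congrFun h k'
    simp only [Pi.sub_apply, Pi.single_apply] at h1 h2 h3 h4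
    have d1 : (1 : ZMod 3) ≠ 0 := by decide
    have d2 : (1 : ZMod 3) - 0 ≠ 0 - 1 := by decide
    have d3 : (1 : ZMod 3) ≠ 0 - 1 := by decide
    by_cases e1 : j = k <;> by_cases e2 : j' = k' <;> by_cases e3 : j = j' <;>
      by_cases e4 : k = k' <;> by_cases e5 : j = k' <;> by_cases e6 : k = j' <;> grind
  · rintro (h | ⟨h, h'⟩)
    · rw [Prod.mk.injEq] at h
      rw [h.1, h.2]
    · simp only at h h'
      rw [h, h', sub_self, sub_self]

theorem sum_addChar_mul_star {r : ℕ} (x y : Fin r → ZMod 3) :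
    ∑ ψ : AddChar (Fin r → ZMod 3) ℂ, ψ x * star (ψ y) =
      if x = y then (Fintype.card (Fin r → ZMod 3) : ℂ) else 0 := by
  have h : ∀ ψ : AddChar (Fin r → ZMod 3) ℂ, ψ x * star (ψ y) = ψ (x - y) := by
    intro ψ
    rw [sub_eq_add_neg, AddChar.map_add_eq_mul, AddChar.map_neg_eq_conj]
    rfl
  simp only [h, AddChar.sum_apply_eq_ite, sub_eq_zero]

/-- Random correlated phases turn `∑ j, u j • A j ⊗ B j` into itself mixed with `A k ⊗ B l`,
`k ≠ l`. -/
theorem isSeparableOp_phase_average {a b r : ℕ} (u : Fin r → ℝ) (hu : ∀ j, 0 ≤ u j)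
    (A : Fin r → Matrix (Fin a) (Fin a) ℂ) (B : Fin r → Matrix (Fin b) (Fin b) ℂ) :
    IsSeparableOp (conjOp (∑ j, (u j : ℂ) • (A j ⊗ₖ B j)) +
      ∑ q ∈ (Finset.univ : Finset (Fin r)).offDiag,
        ((u q.1 * u q.2 : ℝ) : ℂ) • conjOp (A q.1 ⊗ₖ B q.2)) := by
  set s : Fin r → ℝ := fun j => Real.sqrt (u j) with hs
  have hss : ∀ j, (s j : ℂ) * s j = u j := fun j => by
    rw [← Complex.ofReal_mul, hs, Real.mul_self_sqrt (hu j)]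
  set x : Fin r → Fin r → ZMod 3 := fun j => Pi.single j 1 with hx
  set N : ℝ := ((Fintype.card (Fin r → ZMod 3) : ℕ) : ℝ) with hN
  have hN0 : 0 < N := by
    rw [hN]
    exact_mod_cast Fintype.card_pos
  -- Each side receives `√u_j`, with opposite phases on the two sides: the pair `(k, l)` gets
  -- amplitude `√(u_k u_l)` and phase `ψ (e_k - e_l)`, which is trivial for `k = l`.
  have hsep := isSeparableOp_sum (τ := AddChar (Fin r → ZMod 3) ℂ)
    (fun ψ => ∑ j, ((s j : ℂ) * ψ (x j)) • A j)
    (fun ψ => ∑ j, ((s j : ℂ) * star (ψ (x j))) • B j)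
  have hK : ∀ ψ : AddChar (Fin r → ZMod 3) ℂ,
      (∑ j, ((s j : ℂ) * ψ (x j)) • A j) ⊗ₖ (∑ j, ((s j : ℂ) * star (ψ (x j))) • B j) =
        ∑ q : Fin r × Fin r, ((s q.1 * s q.2 : ℂ) * ψ (x q.1 - x q.2)) • (A q.1 ⊗ₖ B q.2) := by
    intro ψ
    ext p p'
    simp only [Matrix.kroneckerMap_apply, Matrix.sum_apply, Matrix.smul_apply, smul_eq_mul,
      Finset.sum_mul_sum, Fintype.sum_prod_type]
    refine Finset.sum_congr rfl fun j _ => Finset.sum_congr rfl fun k _ => ?_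
    rw [sub_eq_add_neg, AddChar.map_add_eq_mul, AddChar.map_neg_eq_conj, ← Complex.star_def]
    ring
  have hsum : ∑ ψ : AddChar (Fin r → ZMod 3) ℂ,
      conjOp ((∑ j, ((s j : ℂ) * ψ (x j)) • A j) ⊗ₖ (∑ j, ((s j : ℂ) * star (ψ (x j))) • B j)) =
      (N : ℂ) • (conjOp (∑ j, (u j : ℂ) • (A j ⊗ₖ B j)) +
      ∑ q ∈ (Finset.univ : Finset (Fin r)).offDiag,
        ((u q.1 * u q.2 : ℝ) : ℂ) • conjOp (A q.1 ⊗ₖ B q.2)) := by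
    ext1 X
    simp only [hK, LinearMap.sum_apply, LinearMap.smul_apply, LinearMap.add_apply, conjOp_sum]
    rw [Finset.sum_comm]
    -- Orthogonality of characters: the interference of the pairs `q` and `q'` survives the average
    -- exactly when their phases agree for every `ψ`.
    have hq : ∀ q q' : Fin r × Fin r,
        ∑ ψ : AddChar (Fin r → ZMod 3) ℂ,
          (((s q.1 * s q.2 : ℂ) * ψ (x q.1 - x q.2)) *
            star ((s q'.1 * s q'.2 : ℂ) * ψ (x q'.1 - x q'.2))) •
              ((A q.1 ⊗ₖ B q.2) * X * (A q'.1 ⊗ₖ B q'.2)ᴴ) =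
        (N : ℂ) • if q = q' ∨ (q.1 = q.2 ∧ q'.1 = q'.2) then
          (s q.1 * s q.2 * (s q'.1 * s q'.2) : ℂ) •
            ((A q.1 ⊗ₖ B q.2) * X * (A q'.1 ⊗ₖ B q'.2)ᴴ) else 0 := by
      intro q q'
      have h1 : ∀ ψ : AddChar (Fin r → ZMod 3) ℂ,
          (((s q.1 * s q.2 : ℂ) * ψ (x q.1 - x q.2)) *
            star ((s q'.1 * s q'.2 : ℂ) * ψ (x q'.1 - x q'.2))) =
          (s q.1 * s q.2 * (s q'.1 * s q'.2) : ℂ) *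
            (ψ (x q.1 - x q.2) * star (ψ (x q'.1 - x q'.2))) := by
        intro ψ
        simp only [star_mul', Complex.star_def, Complex.conj_ofReal]
        ring
      simp only [h1]
      rw [← Finset.sum_smul, ← Finset.mul_sum, sum_addChar_mul_star]
      have hiff : x q.1 - x q.2 = x q'.1 - x q'.2 ↔ _ := pi_single_sub_eq_iff q q'
      by_cases h : x q.1 - x q.2 = x q'.1 - x q'.2
      · rw [if_pos h, if_pos (hiff.1 h), smul_smul, mul_comm, hN]
        simp
      · rw [if_neg h, if_neg fun h' => h (hiff.2 h')]
        simp
    have hcomm : ∀ q : Fin r × Fin r, ∑ ψ : AddChar (Fin r → ZMod 3) ℂ, ∑ q' : Fin r × Fin r,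
          (((s q.1 * s q.2 : ℂ) * ψ (x q.1 - x q.2)) *
            star ((s q'.1 * s q'.2 : ℂ) * ψ (x q'.1 - x q'.2))) •
              ((A q.1 ⊗ₖ B q.2) * X * (A q'.1 ⊗ₖ B q'.2)ᴴ) = _ :=
      fun q => Finset.sum_comm
    simp only [hcomm, hq, ← Finset.smul_sum]
    congr 1
    -- A diagonal pair interferes with all diagonal pairs, which rebuilds the conjugation by the
    -- full sum; an off-diagonal pair survives only with itself.
    rw [← Finset.univ_product_univ, ← Finset.diag_union_offDiag,
      Finset.sum_union (Finset.disjoint_diag_offDiag _)]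
    have hdiag : ∀ f : Fin r × Fin r → BiOp a b,
        ∑ q ∈ (Finset.univ : Finset (Fin r)).diag, f q = ∑ j, f (j, j) := by
      intro f
      exact Finset.sum_diag _ _
    congr 1
    · rw [hdiag]
      refine Finset.sum_congr rfl fun j _ => ?_
      rw [Finset.sum_union (Finset.disjoint_diag_offDiag _), hdiag,
        Finset.sum_eq_zero (s := Finset.univ.offDiag), add_zero]
      · refine Finset.sum_congr rfl fun k _ => ?_
        simp [hss]
      · rintro ⟨k, l⟩ hkl
        rw [Finset.mem_offDiag] at hkl
        rw [if_neg]
        rintro (h | h)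
        · rw [Prod.mk.injEq] at h
          exact hkl.2.2 (h.1.symm.trans h.2)
        · exact hkl.2.2 h.2
    · refine Finset.sum_congr rfl fun q hq => ?_
      rw [Finset.mem_offDiag] at hq
      simp only [hq.2.2, false_and, or_false]
      rw [Finset.diag_union_offDiag, Finset.univ_product_univ, Finset.sum_ite_eq]
      simp only [Finset.mem_univ, if_true]
      rw [conjOp_apply]
      congr 1
      push_cast
      rw [← hss, ← hss]
      ring
  rw [hsum] at hsep
  have h := hsep.smul (c := N⁻¹) (inv_nonneg.2 hN0.le)
  rwa [smul_smul, ← Complex.ofReal_mul, inv_mul_cancel₀ hN0.ne', Complex.ofReal_one,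
    one_smul] at h

/-! ### Separable states -/

theorem isDensity_single {ι : Type} [Fintype ι] [DecidableEq ι] (i : ι) :
    IsDensity (Matrix.single i i (1 : ℂ)) := by
  refine ⟨?_, by simp⟩
  have h := Matrix.posSemidef_vecMulVec_self_star (Pi.single i (1 : ℂ))
  convert h using 1
  ext j k
  simp only [Matrix.single_apply, Matrix.vecMulVec_apply, Pi.star_apply, Pi.single_apply]
  by_cases h1 : i = j <;> by_cases h2 : i = k <;> simp [h1, h2, eq_comm]

/-- A positive operator is its trace times a density operator. -/
theorem exists_density_of_posSemidef {ι : Type} [Fintype ι] [Nonempty ι] {P : Matrix ι ι ℂ}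
    (hP : P.PosSemidef) :
    ∃ ρ : Matrix ι ι ℂ, IsDensity ρ ∧ 0 ≤ P.trace.re ∧ P.trace = (P.trace.re : ℂ) ∧
      P = (P.trace.re : ℂ) • ρ := by
  classical
  have h0 := hP.trace_nonneg
  rw [Complex.nonneg_iff] at h0
  have hre : P.trace = (P.trace.re : ℂ) := by
    apply Complex.ext
    · simp
    · simp [← h0.2]
  by_cases h : P.trace = 0
  · refine ⟨Matrix.single (Classical.arbitrary ι) (Classical.arbitrary ι) 1,
      isDensity_single _, h0.1, hre, ?_⟩
    rw [h]
    simpa using hP.trace_eq_zero_iff.1 h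
  · have hne : P.trace.re ≠ 0 := fun h' => h (by rw [hre, h', Complex.ofReal_zero])
    refine ⟨((P.trace.re⁻¹ : ℝ) : ℂ) • P, ⟨hP.smul ?_, ?_⟩, h0.1, hre, ?_⟩
    · exact_mod_cast inv_nonneg.2 h0.1
    · rw [Matrix.trace_smul, hre, smul_eq_mul, Complex.ofReal_re, ← Complex.ofReal_mul,
        inv_mul_cancel₀ hne, Complex.ofReal_one]
    · rw [smul_smul, ← Complex.ofReal_mul, mul_inv_cancel₀ hne, Complex.ofReal_one, one_smul]

/-- The products of the traces serve as weights; the trace condition makes them sum to one. -/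
theorem isSeparableState_of_sum {ι κ : Type} [Fintype ι] [Fintype κ] [Nonempty ι] [Nonempty κ]
    {m : ℕ} {P : Fin m → Matrix ι ι ℂ} {Q : Fin m → Matrix κ κ ℂ} (hP : ∀ j, (P j).PosSemidef)
    (hQ : ∀ j, (Q j).PosSemidef) (htr : (∑ j, P j ⊗ₖ Q j).trace = 1) :
    IsSeparableState (∑ j, P j ⊗ₖ Q j) := by
  choose ρ hρ hp hp' hPρ using fun j => exists_density_of_posSemidef (hP j)
  choose τ hτ hq hq' hQτ using fun j => exists_density_of_posSemidef (hQ j)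
  refine ⟨m, fun j => (P j).trace.re * (Q j).trace.re, ρ, τ,
    fun j => mul_nonneg (hp j) (hq j), ?_, hρ, hτ, ?_⟩
  · rw [Matrix.trace_sum] at htr
    simp only [Matrix.trace_kronecker] at htr
    apply Complex.ofReal_injective
    rw [← Complex.ofReal_one] at htr
    rw [← htr, Complex.ofReal_sum]
    exact Finset.sum_congr rfl fun j _ => by rw [Complex.ofReal_mul, ← hp', ← hq']
  · refine Finset.sum_congr rfl fun j _ => ?_
    conv_lhs => rw [hPρ j, hQτ j]
    rw [Matrix.smul_kronecker, Matrix.kronecker_smul, smul_smul, Complex.ofReal_mul]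

theorem IsSeparableState.posSemidef {ι κ : Type} [Fintype ι] [Fintype κ]
    {σ : Matrix (ι × κ) (ι × κ) ℂ} (hσ : IsSeparableState σ) : σ.PosSemidef := by
  obtain ⟨m, p, ρ, τ, hp, -, hρ, hτ, rfl⟩ := hσ
  exact Matrix.posSemidef_sum _ fun j _ => ((hρ j).1.kronecker (hτ j).1).smul
    (by exact_mod_cast hp j)

/-! ### The entanglement witness -/

open Finset in
/-- `tr (M Nᵀ) ≤ tr M tr N` for positive `M = CᴴC` and `N = DᴴD`. -/
theorem sum_entries_mul_le_trace_mul_trace {r ι κ : Type} [Fintype r] [Fintype ι] [Fintype κ]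
    (C : Matrix ι r ℂ) (D : Matrix κ r ℂ) :
    (∑ j, ∑ k, (Cᴴ * C) j k * (Dᴴ * D) j k).re ≤ (Cᴴ * C).trace.re * (Dᴴ * D).trace.re := by
  have htr : ∀ (ν : Type) [Fintype ν] (C : Matrix ν r ℂ),
      (Cᴴ * C).trace.re = ∑ i, ∑ j, ‖C i j‖ ^ 2 := by
    intro ν _ C
    simp only [Matrix.trace, Matrix.diag, Matrix.mul_apply, Matrix.conjTranspose_apply,
      Complex.re_sum]
    rw [Finset.sum_comm]
    refine Finset.sum_congr rfl fun i _ => Finset.sum_congr rfl fun j _ => ?_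
    rw [Complex.star_def, ← Complex.normSq_eq_conj_mul_self, Complex.ofReal_re,
      Complex.normSq_eq_norm_sq]
  -- The left side is the squared Hilbert–Schmidt norm of `C Dᵀ`, to whose entries Cauchy–Schwarz
  -- applies.
  have hl : ∑ j, ∑ k, (Cᴴ * C) j k * (Dᴴ * D) j k =
      ((∑ i, ∑ l, ‖∑ j, C i j * D l j‖ ^ 2 : ℝ) : ℂ) := by
    have h1 : ∀ i l, ((‖∑ j, C i j * D l j‖ ^ 2 : ℝ) : ℂ) =
        ∑ j, ∑ k, (star (C i j) * C i k) * (star (D l j) * D l k) := by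
      intro i l
      rw [← Complex.normSq_eq_norm_sq, Complex.normSq_eq_conj_mul_self, map_sum,
        Finset.sum_mul_sum]
      refine Finset.sum_congr rfl fun j _ => Finset.sum_congr rfl fun k _ => ?_
      rw [map_mul]
      simp only [Complex.star_def]
      ring
    push_cast
    push_cast at h1
    simp only [h1, Matrix.mul_apply, Matrix.conjTranspose_apply, Finset.sum_mul_sum]
    calc _ = ∑ j, ∑ i, ∑ k, ∑ l, star (C i j) * C i k * (star (D l j) * D l k) :=
          sum_congr rfl fun j _ => sum_comm
      _ = ∑ i, ∑ j, ∑ k, ∑ l, star (C i j) * C i k * (star (D l j) * D l k) := sum_comm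
      _ = ∑ i, ∑ j, ∑ l, ∑ k, star (C i j) * C i k * (star (D l j) * D l k) :=
          sum_congr rfl fun i _ => sum_congr rfl fun j _ => sum_comm
      _ = _ := sum_congr rfl fun i _ => sum_comm
  rw [hl, Complex.ofReal_re, htr, htr, sum_mul_sum]
  refine sum_le_sum fun i _ => sum_le_sum fun l _ => ?_
  calc ‖∑ j, C i j * D l j‖ ^ 2 ≤ (∑ j, ‖C i j‖ * ‖D l j‖) ^ 2 := by
        gcongr
        exact (norm_sum_le _ _).trans_eq (sum_congr rfl fun j _ => norm_mul _ _)
    _ ≤ _ := sum_mul_sq_le_sq_mul_sq _ _ _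

/-- `1 - X Xᴴ` is a projection, and compressing `ρ` by it leaves a positive operator whose trace is
the difference of the two sides. -/
theorem trace_compress_le {r ι : Type} [Fintype r] [Fintype ι] [DecidableEq r] [DecidableEq ι]
    {X : Matrix ι r ℂ} (hX : Xᴴ * X = 1) {ρ : Matrix ι ι ℂ} (hρ : ρ.PosSemidef) :
    (Xᴴ * ρ * X).trace.re ≤ ρ.trace.re := by
  have h := (hρ.conjTranspose_mul_mul_same (1 - X * Xᴴ)).trace_nonneg
  have hP : (1 - X * Xᴴ) * (1 - X * Xᴴ)ᴴ = 1 - X * Xᴴ := by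
    have : X * Xᴴ * (X * Xᴴ) = X * Xᴴ := by
      rw [Matrix.mul_assoc, ← Matrix.mul_assoc Xᴴ, hX, Matrix.one_mul]
    simp [Matrix.sub_mul, Matrix.mul_sub, this]
  rw [Matrix.mul_assoc, Matrix.trace_mul_comm, Matrix.mul_assoc, hP, Matrix.mul_sub,
    Matrix.mul_one, Matrix.trace_sub, ← Matrix.mul_assoc, Matrix.trace_mul_comm,
    ← Matrix.mul_assoc] at h
  have := (Complex.nonneg_iff.1 h).1
  rw [Complex.sub_re] at this
  linarith

open scoped MatrixOrder in
theorem exists_eq_conjTranspose_mul_self {ι : Type} [Fintype ι] {ρ : Matrix ι ι ℂ}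
    (hρ : ρ.PosSemidef) : ∃ c : Matrix ι ι ℂ, ρ = cᴴ * c := by
  classical
  exact CStarAlgebra.nonneg_iff_eq_star_mul_self.mp hρ.nonneg

/-- The vector `∑ j, x j ⊗ y j`, where `x j` and `y j` are the columns of `X` and `Y`. -/
noncomputable def tensorVec {r ι κ : Type} [Fintype r] (X : Matrix ι r ℂ) (Y : Matrix κ r ℂ) : ι × κ → ℂ :=
  fun p => ∑ j, X p.1 j * Y p.2 j

theorem tensorVec_kronecker {r ι κ : Type} [Fintype r] [Fintype ι] [Fintype κ]
    (X X' : Matrix ι r ℂ) (Y Y' : Matrix κ r ℂ) (ρ : Matrix ι ι ℂ) (τ : Matrix κ κ ℂ) :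
    star (tensorVec X Y) ⬝ᵥ (ρ ⊗ₖ τ) *ᵥ tensorVec X' Y' =
      ∑ j, ∑ k, (Xᴴ * ρ * X') j k * (Yᴴ * τ * Y') j k := by
  classical
  -- With `δ` the unnormalised maximally entangled vector, `tensorVec X Y = (X ⊗ Y) δ`, so `X` and
  -- `Y` can be absorbed into `ρ` and `τ`.
  set δ : r × r → ℂ := fun p => if p.1 = p.2 then 1 else 0 with hδ
  have hv : ∀ (X : Matrix ι r ℂ) (Y : Matrix κ r ℂ), tensorVec X Y = (X ⊗ₖ Y) *ᵥ δ := by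
    intro X Y
    ext p
    simp [tensorVec, Matrix.mulVec, dotProduct, Fintype.sum_prod_type, hδ]
  have hst : star δ = δ := by
    ext p
    simp [hδ, apply_ite star]
  rw [hv, hv, Matrix.star_mulVec, ← Matrix.dotProduct_mulVec, Matrix.mulVec_mulVec,
    Matrix.mulVec_mulVec, Matrix.conjTranspose_kronecker, ← Matrix.mul_kronecker_mul,
    ← Matrix.mul_kronecker_mul, hst]
  simp [Matrix.mulVec, dotProduct, Fintype.sum_prod_type, hδ]

/-- The entanglement witness. On a product state its value is `tr (M Nᵀ)`, where `M` and `N` are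
compressions of density operators by isometries, hence positive of trace at most one. Convexity
gives the rest. -/
theorem tensorVec_separable_le {r ι κ : Type} [Fintype r] [Fintype ι] [Fintype κ]
    [DecidableEq r] [DecidableEq ι] [DecidableEq κ]
    {X : Matrix ι r ℂ} {Y : Matrix κ r ℂ} (hX : Xᴴ * X = 1) (hY : Yᴴ * Y = 1)
    {σ : Matrix (ι × κ) (ι × κ) ℂ} (hσ : IsSeparableState σ) :
    (star (tensorVec X Y) ⬝ᵥ σ *ᵥ tensorVec X Y).re ≤ 1 := by
  obtain ⟨m, p, ρ, τ, hp, hp1, hρ, hτ, rfl⟩ := hσ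
  rw [Matrix.sum_mulVec, dotProduct_sum, Complex.re_sum, ← hp1]
  refine Finset.sum_le_sum fun j _ => ?_
  rw [Matrix.smul_mulVec, dotProduct_smul, smul_eq_mul, Complex.re_ofReal_mul,
    tensorVec_kronecker]
  refine mul_le_of_le_one_right (hp j) ?_
  have hfac : ∀ (ν : Type) [Fintype ν] [DecidableEq ν] (Z : Matrix ν r ℂ), Zᴴ * Z = 1 →
      ∀ ω : Matrix ν ν ℂ, IsDensity ω → ∃ C : Matrix ν r ℂ, Zᴴ * ω * Z = Cᴴ * C ∧
        0 ≤ (Cᴴ * C).trace.re ∧ (Cᴴ * C).trace.re ≤ 1 := by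
    intro ν _ _ Z hZ ω hω
    have htr := trace_compress_le hZ hω.1
    obtain ⟨c, rfl⟩ := exists_eq_conjTranspose_mul_self hω.1
    have h : Zᴴ * (cᴴ * c) * Z = (c * Z)ᴴ * (c * Z) := by
      rw [Matrix.conjTranspose_mul]
      simp only [Matrix.mul_assoc]
    refine ⟨c * Z, h, ?_, ?_⟩
    · exact (Complex.nonneg_iff.1 (Matrix.posSemidef_conjTranspose_mul_self _).trace_nonneg).1
    · rw [← h]
      exact htr.trans_eq (by rw [hω.2, Complex.one_re])
  obtain ⟨C, hC, hC0, hC1⟩ := hfac ι X hX _ (hρ j)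
  obtain ⟨D, hD, hD0, hD1⟩ := hfac κ Y hY _ (hτ j)
  rw [hC, hD]
  exact (sum_entries_mul_le_trace_mul_trace C D).trans (mul_le_one₀ hC1 hD0 hD1)

/-- A pure state that becomes separable by mixing it with `t` parts of `σ` has overlap at most
`1 + t` with `∑ j, x j ⊗ y j`, for orthonormal families `x` and `y`. -/
theorem normSq_overlap_le_of_mem_stateMixing {r ι κ : Type} [Fintype r] [Fintype ι] [Fintype κ]
    [DecidableEq r] [DecidableEq ι] [DecidableEq κ]
    {X : Matrix ι r ℂ} {Y : Matrix κ r ℂ} (hX : Xᴴ * X = 1) (hY : Yᴴ * Y = 1)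
    {v : ι × κ → ℂ} {σ : Matrix (ι × κ) (ι × κ) ℂ} (hσ : σ.PosSemidef) {t : ℝ}
    (ht : t ∈ stateMixing (Matrix.vecMulVec v (star v)) σ) :
    ‖star (tensorVec X Y) ⬝ᵥ v‖ ^ 2 ≤ 1 + t := by
  obtain ⟨ht0, hsep⟩ := ht
  have h := tensorVec_separable_le hX hY hsep
  have h0 := (Complex.nonneg_iff.1 (hσ.dotProduct_mulVec_nonneg (tensorVec X Y))).1
  have hv : (star (tensorVec X Y) ⬝ᵥ Matrix.vecMulVec v (star v) *ᵥ tensorVec X Y).re =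
      ‖star (tensorVec X Y) ⬝ᵥ v‖ ^ 2 := by
    have h1 : star v ⬝ᵥ tensorVec X Y = star (star (tensorVec X Y) ⬝ᵥ v) := by
      rw [Matrix.star_dotProduct]
    rw [Matrix.vecMulVec_mulVec, h1, dotProduct_smul]
    simp only [MulOpposite.smul_eq_mul_unop, MulOpposite.unop_op, Complex.star_def]
    rw [Complex.mul_conj, Complex.ofReal_re, Complex.normSq_eq_norm_sq]
  rw [Matrix.add_mulVec, dotProduct_add, Matrix.smul_mulVec, Matrix.smul_mulVec, dotProduct_smul,
    dotProduct_smul, smul_eq_mul, smul_eq_mul, Complex.add_re, Complex.re_ofReal_mul,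
    Complex.re_ofReal_mul, hv] at h
  have hpos : 0 < 1 + t := by linarith
  -- The noise is only required to be positive here, so the bound covers arbitrary channels and not
  -- just separable ones.
  have h2 : 0 ≤ t / (1 + t) * (star (tensorVec X Y) ⬝ᵥ σ *ᵥ tensorVec X Y).re :=
    mul_nonneg (div_nonneg ht0 hpos.le) h0
  have h3 : 1 / (1 + t) * ‖star (tensorVec X Y) ⬝ᵥ v‖ ^ 2 ≤ 1 := by linarith
  rwa [one_div_mul_eq_div, div_le_one hpos] at h3

/-! ### The state associated with an operation -/

theorem gateState_add {a b : ℕ} (E F : BiOp a b →ₗ[ℂ] BiOp a b) :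
    gateState (E + F) = gateState E + gateState F := rfl

theorem gateState_smul {a b : ℕ} (c : ℂ) (E : BiOp a b →ₗ[ℂ] BiOp a b) :
    gateState (c • E) = c • gateState E := rfl

theorem gateState_sum {a b : ℕ} {τ : Type} [Fintype τ] (E : τ → BiOp a b →ₗ[ℂ] BiOp a b) :
    gateState (∑ j, E j) = ∑ j, gateState (E j) := by
  ext p q
  simp [gateState, actMiddle, Matrix.sum_apply]

theorem gateState_apply {a b : ℕ} (E : BiOp a b →ₗ[ℂ] BiOp a b)
    (p q : (Fin a × Fin a) × (Fin b × Fin b)) :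
    gateState E p q = E (Matrix.vecMulVec
        (fun s => maxEntangled a (p.1.1, s.1) * maxEntangled b (s.2, p.2.2))
        (star fun s => maxEntangled a (q.1.1, s.1) * maxEntangled b (s.2, q.2.2)))
      (p.1.2, p.2.1) (q.1.2, q.2.1) := by
  simp only [gateState, actMiddle, Matrix.of_apply]
  refine congrFun (congrFun (congrArg E ?_) _) _
  ext s t
  simp only [Matrix.of_apply, Matrix.kroneckerMap_apply, Matrix.vecMulVec_apply, Pi.star_apply,
    star_mul']
  ring

/-- `gateState (conjOp K)` is the projection onto this vector. -/
noncomputable def gateVec {a b : ℕ} (K : BiOp a b) : (Fin a × Fin a) × (Fin b × Fin b) → ℂ :=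
  fun p => (((1 / Real.sqrt a : ℝ) : ℂ) * ((1 / Real.sqrt b : ℝ) : ℂ)) *
    K (p.1.2, p.2.1) (p.1.1, p.2.2)

theorem gateState_conjOp {a b : ℕ} (K : BiOp a b) :
    gateState (conjOp K) = Matrix.vecMulVec (gateVec K) (star (gateVec K)) := by
  have h : ∀ p : (Fin a × Fin a) × (Fin b × Fin b),
      (K *ᵥ fun s => maxEntangled a (p.1.1, s.1) * maxEntangled b (s.2, p.2.2))
        (p.1.2, p.2.1) = gateVec K p := by
    intro p
    simp only [Matrix.mulVec, dotProduct, maxEntangled, Fintype.sum_prod_type, gateVec]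
    simp
    ring
  ext p q
  rw [gateState_apply, conjOp_apply, Matrix.mul_vecMulVec, Matrix.vecMulVec_mul,
    ← Matrix.star_mulVec, Matrix.vecMulVec_apply, Matrix.vecMulVec_apply, h, Pi.star_apply, h,
    Pi.star_apply]

theorem gateState_conjOp_kronecker {a b : ℕ} (A : Matrix (Fin a) (Fin a) ℂ)
    (B : Matrix (Fin b) (Fin b) ℂ) :
    ∃ (x : Fin a × Fin a → ℂ) (y : Fin b × Fin b → ℂ), gateState (conjOp (A ⊗ₖ B)) =
      Matrix.vecMulVec x (star x) ⊗ₖ Matrix.vecMulVec y (star y) := by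
  refine ⟨fun p => ((1 / Real.sqrt a : ℝ) : ℂ) * A p.2 p.1,
    fun p => ((1 / Real.sqrt b : ℝ) : ℂ) * B p.1 p.2, ?_⟩
  rw [gateState_conjOp]
  ext p q
  simp only [Matrix.vecMulVec_apply, Matrix.kroneckerMap_apply, gateVec, Pi.star_apply, star_mul']
  ring

theorem trace_gateState {a b : ℕ} (ha : 0 < a) (hb : 0 < b) {E : BiOp a b →ₗ[ℂ] BiOp a b}
    (hE : ∀ X, (E X).trace = X.trace) : (gateState E).trace = 1 := by
  have hm : ∀ d : ℕ, 0 < d → ∑ i : Fin d, ∑ j : Fin d,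
      maxEntangled d (i, j) * star (maxEntangled d (i, j)) = 1 := by
    intro d hd
    have hd' : (d : ℝ) ≠ 0 := by exact_mod_cast hd.ne'
    have hs : ((Real.sqrt d : ℝ) : ℂ) * ((Real.sqrt d : ℝ) : ℂ) = d := by
      rw [← Complex.ofReal_mul, Real.mul_self_sqrt (Nat.cast_nonneg d)]
      simp
    have hs0 : (d : ℂ) ≠ 0 := by exact_mod_cast hd.ne'
    simp only [maxEntangled, apply_ite star, star_zero, mul_ite, ite_mul, zero_mul, mul_zero]
    simp [← mul_inv, hs, hs0]
  have hsw : ∀ i : Fin b, ∀ j : Fin b, maxEntangled b (i, j) = maxEntangled b (j, i) := by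
    intro i j
    simp [maxEntangled, eq_comm]
  -- Tracing out the output for fixed reference indices removes `E`; what remains is the product of
  -- the squared norms of the two maximally entangled vectors.
  calc (gateState E).trace
      = ∑ i : Fin a, ∑ l : Fin b, (E (Matrix.vecMulVec
          (fun s => maxEntangled a (i, s.1) * maxEntangled b (s.2, l))
          (star fun s => maxEntangled a (i, s.1) * maxEntangled b (s.2, l)))).trace := by
        simp only [Matrix.trace, Matrix.diag, gateState_apply, Fintype.sum_prod_type]
        refine Finset.sum_congr rfl fun i _ => ?_
        exact (Finset.sum_congr rfl fun s _ => Finset.sum_comm).trans Finset.sum_comm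
    _ = (∑ i : Fin a, ∑ j : Fin a, maxEntangled a (i, j) * star (maxEntangled a (i, j))) *
        ∑ i : Fin b, ∑ j : Fin b, maxEntangled b (i, j) * star (maxEntangled b (i, j)) := by
        rw [Finset.sum_mul_sum]
        refine Finset.sum_congr rfl fun i _ => Finset.sum_congr rfl fun l _ => ?_
        rw [hE, Matrix.trace_vecMulVec, Finset.sum_mul_sum]
        simp only [dotProduct, Fintype.sum_prod_type, Pi.star_apply, star_mul']
        refine Finset.sum_congr rfl fun j _ => Finset.sum_congr rfl fun k _ => ?_
        rw [hsw k l]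
        ring
    _ = 1 := by rw [hm a ha, hm b hb, one_mul]

/-- Complete positivity is phrased with a single ancilla on the left, so `R_A R_B` is encoded as
`Fin (a * b)`, and a reindexing restores the order `R_A A B R_B`. -/
theorem posSemidef_gateState {a b : ℕ} {E : BiOp a b →ₗ[ℂ] BiOp a b}
    (hE : IsCompletelyPositive E) : (gateState E).PosSemidef := by
  set w : Fin (a * b) × (Fin a × Fin b) → ℂ := fun p =>
    maxEntangled a ((finProdFinEquiv.symm p.1).1, p.2.1) *
      maxEntangled b (p.2.2, (finProdFinEquiv.symm p.1).2) with hw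
  have h := (hE (a * b) _ (Matrix.posSemidef_vecMulVec_self_star w)).submatrix
    (fun p : (Fin a × Fin a) × (Fin b × Fin b) =>
      (finProdFinEquiv (p.1.1, p.2.2), (p.1.2, p.2.1)))
  convert h using 1
  ext p q
  rw [gateState_apply]
  simp only [Matrix.submatrix_apply, ampliate, Matrix.of_apply]
  refine congrFun (congrFun (congrArg E ?_) _) _
  ext s t
  simp only [hw, Matrix.vecMulVec_apply, Matrix.of_apply, Pi.star_apply, Equiv.symm_apply_apply]

/-- A product Kraus operator acts on `A` and `B` separately and so produces a product vector across
the cut `R_A A : B R_B`. -/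
theorem IsSeparableOp.isSeparableState_gateState {a b : ℕ} (ha : 0 < a) (hb : 0 < b)
    {E : BiOp a b →ₗ[ℂ] BiOp a b} (hE : IsSeparableOp E) (htr : ∀ X, (E X).trace = X.trace) :
    IsSeparableState (gateState E) := by
  have : Nonempty (Fin a) := ⟨⟨0, ha⟩⟩
  have : Nonempty (Fin b) := ⟨⟨0, hb⟩⟩
  have h1 := trace_gateState ha hb htr
  obtain ⟨m, A, B, rfl⟩ := hE
  choose x y hxy using fun j => gateState_conjOp_kronecker (A j) (B j)
  rw [gateState_sum] at h1 ⊢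
  simp only [hxy] at h1 ⊢
  exact isSeparableState_of_sum (fun j => Matrix.posSemidef_vecMulVec_self_star _)
    (fun j => Matrix.posSemidef_vecMulVec_self_star _) h1

/-- Carries lower bounds from states to gates, since `E ↦ ρ(E)` is linear. -/
theorem mem_stateMixing_of_mem_gateMixing {a b : ℕ} (ha : 0 < a) (hb : 0 < b)
    {E F : BiOp a b →ₗ[ℂ] BiOp a b} (hE : ∀ X, (E X).trace = X.trace)
    (hF : ∀ X, (F X).trace = X.trace) {t : ℝ} (ht : t ∈ gateMixing E F) :
    t ∈ stateMixing (gateState E) (gateState F) := by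
  refine ⟨ht.1, ?_⟩
  rw [← gateState_smul, ← gateState_smul, ← gateState_add]
  refine ht.2.isSeparableState_gateState ha hb fun X => ?_
  have hpos : (1 + t) ≠ 0 := by linarith [ht.1]
  rw [LinearMap.add_apply, LinearMap.smul_apply, LinearMap.smul_apply, Matrix.trace_add,
    Matrix.trace_smul, Matrix.trace_smul, hE, hF, ← add_smul, ← Complex.ofReal_add, ← add_div,
    div_self hpos, Complex.ofReal_one, one_smul]

/-! ### Operator-Schmidt decompositions -/

theorem offDiagSum_eq {r : ℕ} (u : Fin r → ℝ) :
    offDiagSum u = (∑ j, u j) ^ 2 - ∑ j, u j ^ 2 := by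
  rw [offDiagSum, eq_sub_iff_add_eq', sq, Finset.sum_mul_sum, ← Finset.sum_product',
    ← Finset.diag_union_offDiag, Finset.sum_union (Finset.disjoint_diag_offDiag _)]
  congr 1
  rw [Finset.sum_diag]
  simp only [sq]

theorem offDiagSum_nonneg {r : ℕ} {u : Fin r → ℝ} (hu : ∀ j, 0 ≤ u j) : 0 ≤ offDiagSum u :=
  Finset.sum_nonneg fun _ _ => mul_nonneg (hu _) (hu _)

section Schmidt

variable {a b r : ℕ} {U : BiOp a b} {u : Fin r → ℝ} {A : Fin r → Matrix (Fin a) (Fin a) ℂ}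
  {B : Fin r → Matrix (Fin b) (Fin b) ℂ}

/-- Both sides compute `tr (Uᴴ U)`. -/
theorem IsOperatorSchmidt.sum_sq (h : IsOperatorSchmidt U u A B)
    (hU : U ∈ Matrix.unitaryGroup (Fin a × Fin b) ℂ) : ∑ j, u j ^ 2 = (a : ℝ) * b := by
  have h1 : Uᴴ * U = 1 := Matrix.mem_unitaryGroup_iff'.1 hU
  have h2 : (Uᴴ * U).trace = (a : ℂ) * b := by
    rw [h1, Matrix.trace_one]
    simp
  rw [h.decomp] at h2
  simp only [Matrix.conjTranspose_sum, Matrix.sum_mul, Matrix.mul_sum, Matrix.conjTranspose_smul,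
    Matrix.smul_mul, Matrix.mul_smul, Matrix.trace_sum, Matrix.trace_smul,
    Matrix.conjTranspose_kronecker, ← Matrix.mul_kronecker_mul, Matrix.trace_kronecker,
    h.orthonormal_left, h.orthonormal_right] at h2
  apply Complex.ofReal_injective
  push_cast
  rw [← h2]
  simp [sq]

/-- The operators `A j` as the columns of a matrix indexed by `R_A A`. -/
noncomputable def leftColumns (A : Fin r → Matrix (Fin a) (Fin a) ℂ) : Matrix (Fin a × Fin a) (Fin r) ℂ :=
  Matrix.of fun p j => A j p.2 p.1

/-- The operators `B j` as the columns of a matrix indexed by `B R_B`. -/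
noncomputable def rightColumns (B : Fin r → Matrix (Fin b) (Fin b) ℂ) : Matrix (Fin b × Fin b) (Fin r) ℂ :=
  Matrix.of fun p j => B j p.1 p.2

theorem IsOperatorSchmidt.leftColumns_orthonormal (h : IsOperatorSchmidt U u A B) :
    (leftColumns A)ᴴ * leftColumns A = 1 := by
  ext j k
  rw [Matrix.one_apply, ← h.orthonormal_left j k]
  simp [leftColumns, Matrix.mul_apply, Matrix.trace, Fintype.sum_prod_type]

theorem IsOperatorSchmidt.rightColumns_orthonormal (h : IsOperatorSchmidt U u A B) :
    (rightColumns B)ᴴ * rightColumns B = 1 := by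
  ext j k
  rw [Matrix.one_apply, ← h.orthonormal_right j k]
  simp only [rightColumns, Matrix.mul_apply, Matrix.trace, Fintype.sum_prod_type, Matrix.diag,
    Matrix.conjTranspose_apply, Matrix.of_apply]
  exact Finset.sum_comm

theorem IsOperatorSchmidt.overlap_gateVec (h : IsOperatorSchmidt U u A B) :
    ‖star (tensorVec (leftColumns A) (rightColumns B)) ⬝ᵥ gateVec U‖ ^ 2 =
      (∑ j, u j) ^ 2 / ((a : ℝ) * b) := by
  -- The Schmidt decomposition of the pure state `ρ(U)`; its overlap with the witness vector is the
  -- sum of the Schmidt coefficients.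
  have hv : gateVec U = (((1 / Real.sqrt a : ℝ) : ℂ) * ((1 / Real.sqrt b : ℝ) : ℂ)) •
      tensorVec (leftColumns A * Matrix.diagonal fun j => (u j : ℂ)) (rightColumns B) := by
    ext p
    rw [Pi.smul_apply, smul_eq_mul, gateVec, h.decomp]
    congr 1
    simp only [tensorVec, Matrix.mul_diagonal, Matrix.sum_apply, Matrix.smul_apply, smul_eq_mul,
      Matrix.kroneckerMap_apply, leftColumns, rightColumns, Matrix.of_apply]
    exact Finset.sum_congr rfl fun j _ => by ring
  have ho := tensorVec_kronecker (leftColumns A)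
    (leftColumns A * Matrix.diagonal fun j => (u j : ℂ)) (rightColumns B) (rightColumns B) 1 1
  rw [Matrix.one_kronecker_one, Matrix.one_mulVec] at ho
  rw [hv, dotProduct_smul, ho, Matrix.mul_one, Matrix.mul_one, ← Matrix.mul_assoc,
    h.leftColumns_orthonormal, h.rightColumns_orthonormal, Matrix.one_mul]
  have hs : ∑ j, ∑ k, Matrix.diagonal (fun j => (u j : ℂ)) j k * (1 : Matrix (Fin r) (Fin r) ℂ) j k
      = ((∑ j, u j : ℝ) : ℂ) := by
    simp [Matrix.one_apply]
  rw [hs, smul_eq_mul, ← Complex.ofReal_mul, ← Complex.ofReal_mul, Complex.norm_real,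
    Real.norm_eq_abs, sq_abs, mul_pow, mul_pow, div_pow, div_pow, Real.sq_sqrt (Nat.cast_nonneg a),
    Real.sq_sqrt (Nat.cast_nonneg b)]
  ring

theorem IsOperatorSchmidt.le_of_mem_stateMixing (h : IsOperatorSchmidt U u A B)
    {σ : Matrix ((Fin a × Fin a) × (Fin b × Fin b)) ((Fin a × Fin a) × (Fin b × Fin b)) ℂ}
    (hσ : σ.PosSemidef) {t : ℝ} (ht : t ∈ stateMixing (gateState (conjOp U)) σ) :
    (∑ j, u j) ^ 2 / ((a : ℝ) * b) - 1 ≤ t := by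
  rw [gateState_conjOp] at ht
  have := normSq_overlap_le_of_mem_stateMixing h.leftColumns_orthonormal
    h.rightColumns_orthonormal hσ ht
  rw [h.overlap_gateVec] at this
  linarith

end Schmidt

/-! ### The worst-case noise -/

theorem isLOCC_conjOp_bob {a b : ℕ} {W : Matrix (Fin b) (Fin b) ℂ} (hW : Wᴴ * W = 1) :
    IsLOCC (conjOp ((1 : Matrix (Fin a) (Fin a) ℂ) ⊗ₖ W)) := by
  have h := IsLOCC.bob (a := a) (m := 1) (fun _ => b) (fun _ => W) (by simpa using hW)
    (fun _ => LinearMap.id) fun _ => IsLOCC.done a b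
  simpa using h

/-- Mixtures of local unitaries can be implemented by LOCC. -/
theorem isLOCC_mixture {a b : ℕ} {τ : Type} [Fintype τ] {p : τ → ℝ} (hp : ∀ q, 0 ≤ p q)
    (hp1 : ∑ q, p q = 1) {V : τ → Matrix (Fin a) (Fin a) ℂ} {W : τ → Matrix (Fin b) (Fin b) ℂ}
    (hV : ∀ q, (V q)ᴴ * V q = 1) (hW : ∀ q, (W q)ᴴ * W q = 1) :
    IsLOCC (∑ q, (p q : ℂ) • conjOp (V q ⊗ₖ W q)) := by
  set e := (Fintype.equivFin τ).symm
  have hs : ∀ q, ((Real.sqrt (p q) : ℝ) : ℂ) * star ((Real.sqrt (p q) : ℝ) : ℂ) = p q := by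
    intro q
    rw [Complex.star_def, Complex.conj_ofReal, ← Complex.ofReal_mul, Real.mul_self_sqrt (hp q)]
  -- Alice's Kraus operators `√p_q V_q` yield the outcome `q` with probability `p_q` whatever the
  -- state; told `q`, Bob applies `W_q`.
  have h := IsLOCC.alice (b := b) (m := Fintype.card τ) (fun _ => a)
    (fun i => ((Real.sqrt (p (e i)) : ℝ) : ℂ) • V (e i))
    (by
      rw [e.sum_comp fun q => (((Real.sqrt (p q) : ℝ) : ℂ) • V q)ᴴ *
        (((Real.sqrt (p q) : ℝ) : ℂ) • V q)]
      simp only [Matrix.conjTranspose_smul, Matrix.smul_mul, Matrix.mul_smul, smul_smul, hV]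
      rw [← Finset.sum_smul]
      simp only [hs]
      rw [← Complex.ofReal_sum, hp1, Complex.ofReal_one, one_smul])
    (fun i => conjOp ((1 : Matrix (Fin a) (Fin a) ℂ) ⊗ₖ W (e i)))
    fun i => isLOCC_conjOp_bob (hW (e i))
  convert h using 1
  rw [e.sum_comp fun q => conjOp ((1 : Matrix (Fin a) (Fin a) ℂ) ⊗ₖ W q) ∘ₗ
    conjOp ((((Real.sqrt (p q) : ℝ) : ℂ) • V q) ⊗ₖ (1 : Matrix (Fin b) (Fin b) ℂ))]
  refine Finset.sum_congr rfl fun q _ => ?_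
  ext1 X
  rw [Matrix.smul_kronecker, conjOp_smul, hs]
  simp only [LinearMap.smul_apply, LinearMap.comp_apply, map_smul]
  congr 1
  have hVW : V q ⊗ₖ W q = ((1 : Matrix (Fin a) (Fin a) ℂ) ⊗ₖ W q) *
      (V q ⊗ₖ (1 : Matrix (Fin b) (Fin b) ℂ)) := by
    rw [← Matrix.mul_kronecker_mul, Matrix.one_mul, Matrix.mul_one]
  rw [hVW]
  simp only [conjOp_apply, Matrix.conjTranspose_mul, Matrix.mul_assoc]

theorem conjTranspose_mul_of_mul_conjTranspose {d : ℕ} (hd : 0 < d) {M : Matrix (Fin d) (Fin d) ℂ}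
    (hM : M * Mᴴ = (d : ℂ)⁻¹ • (1 : Matrix (Fin d) (Fin d) ℂ)) : Mᴴ * M = (d : ℂ)⁻¹ • 1 := by
  have hd' : (d : ℂ) ≠ 0 := by exact_mod_cast hd.ne'
  have h : M * ((d : ℂ) • Mᴴ) = 1 := by
    rw [Matrix.mul_smul, hM, smul_smul, mul_inv_cancel₀ hd', one_smul]
  have h2 := mul_eq_one_comm.1 h
  rw [← h2, Matrix.smul_mul, smul_smul, inv_mul_cancel₀ hd', one_smul]

section Noise

variable {a b r : ℕ} {U : BiOp a b} {u : Fin r → ℝ} {A : Fin r → Matrix (Fin a) (Fin a) ℂ}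
  {B : Fin r → Matrix (Fin b) (Fin b) ℂ}

/-- This includes `offDiagSum u = 0`, where division by zero makes the noise the zero map. -/
theorem isSeparableOp_worstNoise (hu : ∀ j, 0 ≤ u j) : IsSeparableOp (worstNoise u A B) :=
  (isSeparableOp_finset_sum _ _ fun _ _ =>
    (isSeparableOp_kronecker _ _).smul (mul_nonneg (hu _) (hu _))).smul
    (div_nonneg (by positivity) (offDiagSum_nonneg hu))

theorem IsUnitarySchmidt.isLOCC_worstNoise (ha : 0 < a) (hb : 0 < b)
    (h : IsUnitarySchmidt U u A B) (hoff : 0 < offDiagSum u) : IsLOCC (worstNoise u A B) := by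
  have hsc : ∀ d : ℕ, 0 < d → ∀ M : Matrix (Fin d) (Fin d) ℂ,
      M * Mᴴ = (d : ℂ)⁻¹ • (1 : Matrix (Fin d) (Fin d) ℂ) →
      (((Real.sqrt d : ℝ) : ℂ) • M)ᴴ * (((Real.sqrt d : ℝ) : ℂ) • M) = 1 := by
    intro d hd M hM
    have hd' : (d : ℂ) ≠ 0 := by exact_mod_cast hd.ne'
    rw [Matrix.conjTranspose_smul, Matrix.smul_mul, Matrix.mul_smul,
      conjTranspose_mul_of_mul_conjTranspose hd hM, smul_smul, smul_smul, Complex.star_def,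
      Complex.conj_ofReal, ← Complex.ofReal_mul,
      Real.mul_self_sqrt (Nat.cast_nonneg d), Complex.ofReal_natCast, mul_inv_cancel₀ hd', one_smul]
  -- `√a A_k` and `√b B_l` are unitary; the rescaling absorbs the factor `a b` of the noise and
  -- leaves the probabilities `u_k u_l / offDiagSum u`.
  have hL := isLOCC_mixture (τ := (Finset.univ : Finset (Fin r)).offDiag)
    (p := fun q => u q.1.1 * u q.1.2 / offDiagSum u)
    (V := fun q => ((Real.sqrt a : ℝ) : ℂ) • A q.1.1)
    (W := fun q => ((Real.sqrt b : ℝ) : ℂ) • B q.1.2)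
    (fun q => div_nonneg (mul_nonneg (h.nonneg _) (h.nonneg _)) hoff.le)
    (by
      rw [Finset.sum_coe_sort _ fun q : Fin r × Fin r => u q.1 * u q.2 / offDiagSum u,
        ← Finset.sum_div]
      exact div_self hoff.ne')
    (fun q => hsc a ha _ (h.unitary_left _)) (fun q => hsc b hb _ (h.unitary_right _))
  convert hL using 1
  rw [Finset.sum_coe_sort _ fun q : Fin r × Fin r => ((u q.1 * u q.2 / offDiagSum u : ℝ) : ℂ) •
    conjOp ((((Real.sqrt a : ℝ) : ℂ) • A q.1) ⊗ₖ (((Real.sqrt b : ℝ) : ℂ) • B q.2)),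
    worstNoise, Finset.smul_sum]
  refine Finset.sum_congr rfl fun q _ => ?_
  rw [Matrix.smul_kronecker, Matrix.kronecker_smul, conjOp_smul, conjOp_smul, smul_smul, smul_smul,
    smul_smul]
  congr 1
  simp only [Complex.star_def, Complex.conj_ofReal]
  simp only [← Complex.ofReal_mul]
  rw [Real.mul_self_sqrt (Nat.cast_nonneg a),
    Real.mul_self_sqrt (Nat.cast_nonneg b)]
  congr 1
  ring

theorem IsUnitarySchmidt.trace_conjOp_kronecker (ha : 0 < a) (hb : 0 < b)
    (h : IsUnitarySchmidt U u A B) (j k : Fin r) (X : BiOp a b) :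
    (conjOp (A j ⊗ₖ B k) X).trace = ((a : ℂ)⁻¹ * (b : ℂ)⁻¹) * X.trace := by
  apply trace_conjOp_of_conjTranspose_mul
  rw [Matrix.conjTranspose_kronecker, ← Matrix.mul_kronecker_mul,
    conjTranspose_mul_of_mul_conjTranspose ha (h.unitary_left j),
    conjTranspose_mul_of_mul_conjTranspose hb (h.unitary_right k), Matrix.smul_kronecker,
    Matrix.kronecker_smul, smul_smul, Matrix.one_kronecker_one]

theorem IsUnitarySchmidt.isChannel_worstNoise (ha : 0 < a) (hb : 0 < b)
    (h : IsUnitarySchmidt U u A B) (hoff : 0 < offDiagSum u) : IsChannel (worstNoise u A B) := by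
  refine ⟨(isSeparableOp_worstNoise h.nonneg).isCompletelyPositive, fun X => ?_⟩
  have ha' : (a : ℂ) ≠ 0 := by exact_mod_cast ha.ne'
  have hb' : (b : ℂ) ≠ 0 := by exact_mod_cast hb.ne'
  have ho' : (offDiagSum u : ℂ) ≠ 0 := by exact_mod_cast hoff.ne'
  simp only [worstNoise, LinearMap.smul_apply, LinearMap.sum_apply, Matrix.trace_smul,
    Matrix.trace_sum, h.trace_conjOp_kronecker ha hb, smul_eq_mul]
  rw [← Finset.sum_mul, ← Complex.ofReal_sum]
  change _ * ((offDiagSum u : ℂ) * _) = _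
  push_cast
  field_simp

theorem IsOperatorSchmidt.robustness_eq (h : IsOperatorSchmidt U u A B) (ha : 0 < a) (hb : 0 < b)
    (hU : U ∈ Matrix.unitaryGroup (Fin a × Fin b) ℂ) :
    (∑ j, u j) ^ 2 / ((a : ℝ) * b) - 1 = offDiagSum u / ((a : ℝ) * b) := by
  have ha' : (a : ℝ) ≠ 0 := by exact_mod_cast ha.ne'
  have hb' : (b : ℝ) ≠ 0 := by exact_mod_cast hb.ne'
  rw [offDiagSum_eq, h.sum_sq hU, sub_div, div_self (mul_ne_zero ha' hb')]

theorem IsOperatorSchmidt.isSeparableOp_add_worstNoise (h : IsOperatorSchmidt U u A B)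
    (ha : 0 < a) (hb : 0 < b) (hoff : 0 < offDiagSum u) :
    IsSeparableOp (conjOp U + ((offDiagSum u / ((a : ℝ) * b) : ℝ) : ℂ) • worstNoise u A B) := by
  have ha' : (a : ℝ) ≠ 0 := by exact_mod_cast ha.ne'
  have hb' : (b : ℝ) ≠ 0 := by exact_mod_cast hb.ne'
  have hs := isSeparableOp_phase_average u h.nonneg A B
  rw [← h.decomp] at hs
  rw [worstNoise, smul_smul, ← Complex.ofReal_mul,
    div_mul_div_cancel₀ (mul_ne_zero ha' hb'), div_self hoff.ne', Complex.ofReal_one, one_smul]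
  exact hs

theorem mem_gateMixing_of_isSeparableOp {E F : BiOp a b →ₗ[ℂ] BiOp a b} {t : ℝ} (ht : 0 ≤ t)
    (h : IsSeparableOp (E + (t : ℂ) • F)) : t ∈ gateMixing E F := by
  refine ⟨ht, ?_⟩
  have h1 := h.smul (c := 1 / (1 + t)) (by positivity)
  rwa [smul_add, smul_smul, ← Complex.ofReal_mul, one_div_mul_eq_div] at h1

theorem IsUnitarySchmidt.exists_separable_noise (h : IsUnitarySchmidt U u A B)
    (ha : 0 < a) (hb : 0 < b) (hU : U ∈ Matrix.unitaryGroup (Fin a × Fin b) ℂ) :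
    ∃ F, IsChannel F ∧ IsSeparableOp F ∧
      offDiagSum u / ((a : ℝ) * b) ∈ gateMixing (conjOp U) F := by
  have h0 : 0 ≤ offDiagSum u / ((a : ℝ) * b) :=
    div_nonneg (offDiagSum_nonneg h.nonneg) (by positivity)
  rcases (offDiagSum_nonneg h.nonneg).lt_or_eq with hoff | hoff
  · exact ⟨_, h.isChannel_worstNoise ha hb hoff, isSeparableOp_worstNoise h.nonneg,
      mem_gateMixing_of_isSeparableOp h0 (h.isSeparableOp_add_worstNoise ha hb hoff)⟩
  -- All off-diagonal terms vanish, so the gate is itself separable; it serves as its own noise,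
  -- with `t = 0`.
  · have hs := isSeparableOp_phase_average u h.nonneg A B
    rw [← h.decomp, Finset.sum_eq_zero, add_zero] at hs
    · refine ⟨_, isChannel_conjOp hU, hs, mem_gateMixing_of_isSeparableOp h0 ?_⟩
      rw [← hoff]
      simpa using hs
    · intro q hq
      have := (Finset.sum_eq_zero_iff_of_nonneg fun q _ =>
        mul_nonneg (h.nonneg q.1) (h.nonneg q.2)).1 hoff.symm q hq
      rw [this, Complex.ofReal_zero, zero_smul]

theorem IsUnitarySchmidt.robustness (h : IsUnitarySchmidt U u A B)
    (ha : 0 < a) (hb : 0 < b) (hU : U ∈ Matrix.unitaryGroup (Fin a × Fin b) ℂ) {R : ℝ}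
    (hR : R = (∑ j, u j) ^ 2 / ((a : ℝ) * b) - 1) :
    (globalRobustness (conjOp U) = ENNReal.ofReal R ∧
      separableRobustness (conjOp U) = ENNReal.ofReal R ∧
      stateRobustness (gateState (conjOp U)) = ENNReal.ofReal R) ∧
    (IsLeast {t | ∃ F, IsChannel F ∧ t ∈ gateMixing (conjOp U) F} R ∧
      IsLeast {t | ∃ F, IsChannel F ∧ IsSeparableOp F ∧ t ∈ gateMixing (conjOp U) F} R ∧
      IsLeast {t | ∃ σ, IsSeparableState σ ∧ t ∈ stateMixing (gateState (conjOp U)) σ} R) ∧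
    (0 < offDiagSum u →
      IsChannel (worstNoise u A B) ∧
      IsSeparableOp (worstNoise u A B) ∧
      IsLOCC (worstNoise u A B) ∧
      IsSeparableOp (conjOp U + (R : ℂ) • worstNoise u A B) ∧
      gateRelRobustness (conjOp U) (worstNoise u A B) = globalRobustness (conjOp U)) := by
  have hR' : R = offDiagSum u / ((a : ℝ) * b) := hR.trans (h.robustness_eq ha hb hU)
  have hR0 : 0 ≤ R := hR' ▸ div_nonneg (offDiagSum_nonneg h.nonneg) (by positivity)
  have hUtr := (isChannel_conjOp hU).2
  have hlowS : ∀ σ, σ.PosSemidef → ∀ t ∈ stateMixing (gateState (conjOp U)) σ, R ≤ t :=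
    fun σ hσ t ht => hR.le.trans (h.le_of_mem_stateMixing hσ ht)
  have hlowG : ∀ F, IsChannel F → ∀ t ∈ gateMixing (conjOp U) F, R ≤ t := fun F hF t ht =>
    hlowS _ (posSemidef_gateState hF.1) t (mem_stateMixing_of_mem_gateMixing ha hb hUtr hF.2 ht)
  -- One separable channel attains all three minima, the third one through its state `gateState F`.
  obtain ⟨F, hF, hFs, hFR⟩ := h.exists_separable_noise ha hb hU
  rw [← hR'] at hFR
  have hσs := hFs.isSeparableState_gateState ha hb hF.2
  have hσR := mem_stateMixing_of_mem_gateMixing ha hb hUtr hF.2 hFR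
  have hrelG : ∀ F, IsChannel F → ENNReal.ofReal R ≤ gateRelRobustness (conjOp U) F := by
    rintro F hF
    refine le_sInf ?_
    rintro _ ⟨t, ht, rfl⟩
    exact ENNReal.ofReal_le_ofReal (hlowG F hF t ht)
  have hrel : gateRelRobustness (conjOp U) F ≤ ENNReal.ofReal R := sInf_le ⟨R, hFR, rfl⟩
  have hglob : globalRobustness (conjOp U) = ENNReal.ofReal R := by
    have hle : globalRobustness (conjOp U) ≤ gateRelRobustness (conjOp U) F := sInf_le ⟨F, hF, rfl⟩
    refine le_antisymm (hle.trans hrel) (le_sInf ?_)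
    rintro _ ⟨F, hF, rfl⟩
    exact hrelG F hF
  refine ⟨⟨hglob, ?_, ?_⟩, ⟨⟨⟨F, hF, hFR⟩, ?_⟩, ⟨⟨F, hF, hFs, hFR⟩, ?_⟩, ⟨⟨_, hσs, hσR⟩, ?_⟩⟩, ?_⟩
  · have hle : separableRobustness (conjOp U) ≤ gateRelRobustness (conjOp U) F :=
      sInf_le ⟨F, hF, hFs, rfl⟩
    refine le_antisymm (hle.trans hrel) (le_sInf ?_)
    rintro _ ⟨F, hF, -, rfl⟩
    exact hrelG F hF
  · have hle : stateRobustness (gateState (conjOp U)) ≤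
        stateRelRobustness (gateState (conjOp U)) (gateState F) := sInf_le ⟨_, hσs, rfl⟩
    have hrelS : stateRelRobustness (gateState (conjOp U)) (gateState F) ≤ ENNReal.ofReal R :=
      sInf_le ⟨R, hσR, rfl⟩
    refine le_antisymm (hle.trans hrelS) (le_sInf ?_)
    rintro _ ⟨σ, hσ, rfl⟩
    refine le_sInf ?_
    rintro _ ⟨t, ht, rfl⟩
    exact ENNReal.ofReal_le_ofReal (hlowS σ hσ.posSemidef t ht)
  · rintro t ⟨F, hF, ht⟩
    exact hlowG F hF t ht
  · rintro t ⟨F, hF, -, ht⟩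
    exact hlowG F hF t ht
  · rintro t ⟨σ, hσ, ht⟩
    exact hlowS σ hσ.posSemidef t ht
  · intro hoff
    have hW := h.isChannel_worstNoise ha hb hoff
    have hsep := h.isSeparableOp_add_worstNoise ha hb hoff
    rw [← hR'] at hsep
    refine ⟨hW, isSeparableOp_worstNoise h.nonneg, h.isLOCC_worstNoise ha hb hoff, hsep, ?_⟩
    rw [hglob]
    exact le_antisymm (sInf_le ⟨R, mem_gateMixing_of_isSeparableOp hR0 hsep, rfl⟩) (hrelG _ hW)

end Noise

/-! ### Noisy circuits -/

/-- The operator `σ₁ ⊗ ⋯ ⊗ σₙ`. -/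
noncomputable def prodOp {n : ℕ} (σ : Fin n → Matrix (Fin 2) (Fin 2) ℂ) : QubitOp n :=
  Matrix.of fun x y => ∏ i, σ i (x i) (y i)

theorem prodOp_smul {n : ℕ} (c : Fin n → ℂ) (σ : Fin n → Matrix (Fin 2) (Fin 2) ℂ) :
    prodOp (fun i => c i • σ i) = (∏ i, c i) • prodOp σ := by
  ext x y
  simp [prodOp, Finset.prod_mul_distrib]

theorem isFullySeparable_of_sum {n : ℕ} {τ : Type} [Fintype τ] {w : τ → ℝ} (hw : ∀ k, 0 ≤ w k)
    {P : τ → Fin n → Matrix (Fin 2) (Fin 2) ℂ} (hP : ∀ k i, (P k i).PosSemidef)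
    (htr : ∑ k, (w k : ℂ) * ∏ i, (P k i).trace = 1) :
    IsFullySeparable (∑ k, (w k : ℂ) • prodOp (P k)) := by
  choose ρ hρ hp hp' hPρ using fun k i => exists_density_of_posSemidef (hP k i)
  have hP' : ∀ k, (w k : ℂ) • prodOp (P k) =
      ((w k * ∏ i, (P k i).trace.re : ℝ) : ℂ) • prodOp (ρ k) := by
    intro k
    have h : P k = fun i => ((P k i).trace.re : ℂ) • ρ k i := funext fun i => hPρ k i
    rw [Complex.ofReal_mul, ← smul_smul, Complex.ofReal_prod, ← prodOp_smul, ← h]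
  set e := (Fintype.equivFin τ).symm
  refine ⟨Fintype.card τ, fun k => w (e k) * ∏ i, (P (e k) i).trace.re, fun k => ρ (e k),
    fun k => mul_nonneg (hw _) (Finset.prod_nonneg fun i _ => hp _ i), ?_, fun k => hρ _, ?_⟩
  · rw [e.sum_comp fun k => w k * ∏ i, (P k i).trace.re]
    apply Complex.ofReal_injective
    rw [Complex.ofReal_one, ← htr, Complex.ofReal_sum]
    refine Finset.sum_congr rfl fun k _ => ?_
    rw [Complex.ofReal_mul, Complex.ofReal_prod]
    simp only [← hp']
  · simp only [hP']
    exact (e.sum_comp fun k => ((w k * ∏ i, (P k i).trace.re : ℝ) : ℂ) • prodOp (ρ k)).symm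

theorem isFullySeparable_single {n : ℕ} (x : Fin n → Fin 2) :
    IsFullySeparable (Matrix.single x x (1 : ℂ)) := by
  refine ⟨1, fun _ => 1, fun _ i => Matrix.single (x i) (x i) 1, fun _ => zero_le_one, by simp,
    fun _ i => isDensity_single _, ?_⟩
  ext y z
  simp [Matrix.single_apply, Finset.prod_ite_zero, funext_iff, forall_and]

theorem applyOne_sum {n : ℕ} {τ : Type} [Fintype τ]
    (E : Matrix (Fin 2) (Fin 2) ℂ →ₗ[ℂ] Matrix (Fin 2) (Fin 2) ℂ) (i : Fin n) (w : τ → ℂ)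
    (ρ : τ → QubitOp n) : applyOne E i (∑ k, w k • ρ k) = ∑ k, w k • applyOne E i (ρ k) := by
  ext x y
  have h : (Matrix.of fun s t => (∑ k, w k • ρ k) (Function.update x i s) (Function.update y i t)) =
      ∑ k, w k • Matrix.of fun s t => ρ k (Function.update x i s) (Function.update y i t) := by
    ext s t
    simp [Matrix.sum_apply]
  simp only [applyOne, Matrix.of_apply]
  rw [h, map_sum]
  simp only [map_smul, Matrix.sum_apply, Matrix.smul_apply, Matrix.of_apply]

theorem applyTwo_sum {n : ℕ} {τ : Type} [Fintype τ] (E : BiOp 2 2 →ₗ[ℂ] BiOp 2 2) (i j : Fin n)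
    (w : τ → ℂ) (ρ : τ → QubitOp n) :
    applyTwo E i j (∑ k, w k • ρ k) = ∑ k, w k • applyTwo E i j (ρ k) := by
  ext x y
  have h : (Matrix.of fun s t : Fin 2 × Fin 2 => (∑ k, w k • ρ k)
        (Function.update (Function.update x i s.1) j s.2)
        (Function.update (Function.update y i t.1) j t.2)) =
      ∑ k, w k • Matrix.of fun s t : Fin 2 × Fin 2 => ρ k
        (Function.update (Function.update x i s.1) j s.2)
        (Function.update (Function.update y i t.1) j t.2) := by
    ext s t
    simp [Matrix.sum_apply]
  simp only [applyTwo, Matrix.of_apply]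
  rw [h, map_sum]
  simp only [map_smul, Matrix.sum_apply, Matrix.smul_apply, Matrix.of_apply]

theorem applyTwo_sum_left {n : ℕ} {τ : Type} [Fintype τ] (E : τ → BiOp 2 2 →ₗ[ℂ] BiOp 2 2)
    (i j : Fin n) (ρ : QubitOp n) :
    applyTwo (∑ k, E k) i j ρ = ∑ k, applyTwo (E k) i j ρ := by
  ext x y
  simp [applyTwo, Matrix.sum_apply]

theorem prod_eq_mul_prod_erase {n : ℕ} (i : Fin n) (f : Fin n → ℂ) :
    ∏ l, f l = f i * ∏ l ∈ Finset.univ.erase i, f l :=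
  (Finset.mul_prod_erase _ _ (Finset.mem_univ i)).symm

theorem prod_eq_mul_mul_prod_erase {n : ℕ} {i j : Fin n} (hij : i ≠ j) (f : Fin n → ℂ) :
    ∏ l, f l = f i * f j * ∏ l ∈ (Finset.univ.erase i).erase j, f l := by
  rw [prod_eq_mul_prod_erase i, mul_assoc,
    Finset.mul_prod_erase _ _ (Finset.mem_erase.2 ⟨hij.symm, Finset.mem_univ j⟩)]

theorem applyOne_prodOp {n : ℕ} (E : Matrix (Fin 2) (Fin 2) ℂ →ₗ[ℂ] Matrix (Fin 2) (Fin 2) ℂ)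
    (i : Fin n) (σ : Fin n → Matrix (Fin 2) (Fin 2) ℂ) :
    applyOne E i (prodOp σ) = prodOp (Function.update σ i (E (σ i))) := by
  ext x y
  -- With the indices of the other qubits frozen, a product operator is a scalar multiple of its
  -- `i`-th factor.
  have h : (Matrix.of fun s t => prodOp σ (Function.update x i s) (Function.update y i t)) =
      (∏ l ∈ Finset.univ.erase i, σ l (x l) (y l)) • σ i := by
    ext s t
    simp only [prodOp, Matrix.of_apply, Matrix.smul_apply, smul_eq_mul]
    rw [prod_eq_mul_prod_erase i, mul_comm]
    simp only [Function.update_self]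
    congr 1
    refine Finset.prod_congr rfl fun l hl => ?_
    have := Finset.ne_of_mem_erase hl
    rw [Function.update_of_ne this, Function.update_of_ne this]
  simp only [applyOne, Matrix.of_apply]
  rw [h, map_smul, prodOp, Matrix.of_apply, prod_eq_mul_prod_erase i, mul_comm,
    Function.update_self, Matrix.smul_apply, smul_eq_mul]
  congr 1
  refine Finset.prod_congr rfl fun l hl => ?_
  rw [Function.update_of_ne (Finset.ne_of_mem_erase hl)]

theorem applyTwo_conjOp_prodOp {n : ℕ} (A B : Matrix (Fin 2) (Fin 2) ℂ) {i j : Fin n} (hij : i ≠ j)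
    (σ : Fin n → Matrix (Fin 2) (Fin 2) ℂ) :
    applyTwo (conjOp (A ⊗ₖ B)) i j (prodOp σ) =
      prodOp (Function.update (Function.update σ i (conjOp A (σ i))) j (conjOp B (σ j))) := by
  have hne : ∀ l ∈ (Finset.univ.erase i).erase j, l ≠ i ∧ l ≠ j := fun l hl => by
    rw [Finset.mem_erase, Finset.mem_erase] at hl
    exact ⟨hl.2.1, hl.1⟩
  ext x y
  have h : (Matrix.of fun s t : Fin 2 × Fin 2 => prodOp σ
        (Function.update (Function.update x i s.1) j s.2)
        (Function.update (Function.update y i t.1) j t.2)) =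
      (∏ l ∈ (Finset.univ.erase i).erase j, σ l (x l) (y l)) • (σ i ⊗ₖ σ j) := by
    ext s t
    simp only [prodOp, Matrix.of_apply, Matrix.smul_apply, smul_eq_mul, Matrix.kroneckerMap_apply]
    rw [prod_eq_mul_mul_prod_erase hij, mul_comm]
    simp only [Function.update_self, Function.update_of_ne hij]
    congr 1
    refine Finset.prod_congr rfl fun l hl => ?_
    simp only [Function.update_of_ne (hne l hl).1, Function.update_of_ne (hne l hl).2]
  have hc : conjOp (A ⊗ₖ B) (σ i ⊗ₖ σ j) = conjOp A (σ i) ⊗ₖ conjOp B (σ j) := by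
    simp only [conjOp_apply, Matrix.conjTranspose_kronecker, ← Matrix.mul_kronecker_mul]
  simp only [applyTwo, Matrix.of_apply]
  rw [h, map_smul, hc, prodOp, Matrix.of_apply, prod_eq_mul_mul_prod_erase hij, mul_comm,
    Function.update_self, Function.update_of_ne hij, Function.update_self, Matrix.smul_apply,
    smul_eq_mul, Matrix.kroneckerMap_apply]
  congr 1
  refine Finset.prod_congr rfl fun l hl => ?_
  rw [Function.update_of_ne (hne l hl).2, Function.update_of_ne (hne l hl).1]

theorem IsChannel.isDensity {ι κ : Type} [Fintype ι] [Fintype κ]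
    {E : Matrix ι ι ℂ →ₗ[ℂ] Matrix κ κ ℂ} (hE : IsChannel E) {ρ : Matrix ι ι ℂ}
    (hρ : IsDensity ρ) : IsDensity (E ρ) :=
  -- Positivity is complete positivity with a one-dimensional ancilla.
  ⟨(hE.1 1 _ (hρ.1.submatrix Prod.snd)).submatrix fun k => (0, k), (hE.2 ρ).trans hρ.2⟩

theorem IsFullySeparable.applyOne {n : ℕ} {ρ : QubitOp n} (hρ : IsFullySeparable ρ)
    {E : Matrix (Fin 2) (Fin 2) ℂ →ₗ[ℂ] Matrix (Fin 2) (Fin 2) ℂ} (hE : IsChannel E) (i : Fin n) :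
    IsFullySeparable (applyOne E i ρ) := by
  obtain ⟨m, p, σ, hp, hp1, hσ, rfl⟩ := hρ
  refine ⟨m, p, fun k => Function.update (σ k) i (E (σ k i)), hp, hp1, fun k l => ?_, ?_⟩
  · by_cases hl : l = i
    · subst hl
      simp only [Function.update_self]
      exact hE.isDensity (hσ k l)
    · simp only [Function.update_of_ne hl]
      exact hσ k l
  · rw [applyOne_sum]
    exact Finset.sum_congr rfl fun k _ => congrArg _ (applyOne_prodOp E i (σ k))

theorem IsFullySeparable.applyTwo {n : ℕ} {ρ : QubitOp n} (hρ : IsFullySeparable ρ)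
    {G : BiOp 2 2 →ₗ[ℂ] BiOp 2 2} (hG : IsSeparableOp G) (htr : ∀ X, (G X).trace = X.trace)
    {i j : Fin n} (hij : i ≠ j) : IsFullySeparable (applyTwo G i j ρ) := by
  obtain ⟨m, p, σ, hp, hp1, hσ, rfl⟩ := hρ
  obtain ⟨m', A, B, rfl⟩ := hG
  -- Single Kraus branches need not preserve the trace. Trace preservation of `G` on `σ_i ⊗ σ_j`
  -- says that the branch probabilities sum to one.
  have hone : ∀ k, ∑ l, (conjOp (A l) (σ k i)).trace * (conjOp (B l) (σ k j)).trace = 1 := by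
    intro k
    have h := htr (σ k i ⊗ₖ σ k j)
    rw [Matrix.trace_kronecker, (hσ k i).2, (hσ k j).2, mul_one, LinearMap.sum_apply,
      Matrix.trace_sum] at h
    rw [← h]
    refine Finset.sum_congr rfl fun l _ => ?_
    rw [← Matrix.trace_kronecker]
    simp only [conjOp_apply, Matrix.conjTranspose_kronecker, ← Matrix.mul_kronecker_mul]
  have hs := isFullySeparable_of_sum (τ := Fin m × Fin m') (w := fun q => p q.1)
    (P := fun q => Function.update (Function.update (σ q.1) i (conjOp (A q.2) (σ q.1 i))) j
      (conjOp (B q.2) (σ q.1 j))) (fun q => hp _) (fun q l => ?_) ?_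
  · convert hs using 1
    have h := applyTwo_sum (∑ l, conjOp (A l ⊗ₖ B l)) i j (fun k => (p k : ℂ))
      fun k => prodOp (σ k)
    refine h.trans ?_
    rw [Fintype.sum_prod_type]
    refine Finset.sum_congr rfl fun k _ => ?_
    rw [applyTwo_sum_left, Finset.smul_sum]
    exact Finset.sum_congr rfl fun l _ => by rw [applyTwo_conjOp_prodOp _ _ hij]
  · by_cases hlj : l = j
    · subst hlj
      rw [Function.update_self]
      exact (hσ _ _).1.mul_mul_conjTranspose_same _
    · rw [Function.update_of_ne hlj]
      by_cases hli : l = i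
      · subst hli
        rw [Function.update_self]
        exact (hσ _ _).1.mul_mul_conjTranspose_same _
      · rw [Function.update_of_ne hli]
        exact (hσ _ _).1
  · have hprod : ∀ q : Fin m × Fin m',
        ∏ l, (Function.update (Function.update (σ q.1) i (conjOp (A q.2) (σ q.1 i))) j
          (conjOp (B q.2) (σ q.1 j)) l).trace =
        (conjOp (A q.2) (σ q.1 i)).trace * (conjOp (B q.2) (σ q.1 j)).trace := by
      intro q
      rw [prod_eq_mul_mul_prod_erase hij, Finset.prod_eq_one, mul_one, Function.update_self,
        Function.update_of_ne hij, Function.update_self]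
      intro l hl
      rw [Finset.mem_erase, Finset.mem_erase] at hl
      rw [Function.update_of_ne hl.1, Function.update_of_ne hl.2.1]
      exact (hσ _ _).2
    simp only [hprod]
    rw [Fintype.sum_prod_type]
    simp only [← Finset.mul_sum, hone, mul_one]
    rw [← Complex.ofReal_sum, hp1, Complex.ofReal_one]

theorem Reachable.isFullySeparable {G : BiOp 2 2 →ₗ[ℂ] BiOp 2 2} (hG : IsSeparableOp G)
    (htr : ∀ X, (G X).trace = X.trace) {n : ℕ} {ρ : QubitOp n} (hρ : Reachable G ρ) :
    IsFullySeparable ρ := by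
  induction hρ with
  | init x => exact isFullySeparable_single x
  | one i E hE ρ _ ih => exact ih.applyOne hE i
  | two i j hij ρ _ ih => exact ih.applyTwo hG htr hij

theorem trace_noisyGate {a b : ℕ} {U : BiOp a b} {F : BiOp a b →ₗ[ℂ] BiOp a b}
    (hU : U ∈ Matrix.unitaryGroup (Fin a × Fin b) ℂ) (hF : IsChannel F) (p : ℝ) (X : BiOp a b) :
    (noisyGate U F p X).trace = X.trace := by
  rw [noisyGate, LinearMap.add_apply, LinearMap.smul_apply, LinearMap.smul_apply, Matrix.trace_add,
    Matrix.trace_smul, Matrix.trace_smul, hF.2, (isChannel_conjOp hU).2, ← add_smul,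
    ← Complex.ofReal_add, sub_add_cancel, Complex.ofReal_one, one_smul]

/-- `(1 - p) U + p F = (1 - p) (U + F) + (2 p - 1) F`, with nonnegative coefficients exactly for `p`
in `[1/2, 1]`. -/
theorem isSeparableOp_noisyGate {a b : ℕ} {U : BiOp a b} {F : BiOp a b →ₗ[ℂ] BiOp a b}
    (hF : IsSeparableOp F) (hUF : IsSeparableOp (conjOp U + F)) {p : ℝ}
    (hp : p ∈ Set.Icc (1 / 2 : ℝ) 1) : IsSeparableOp (noisyGate U F p) := by
  have h := (hUF.smul (c := 1 - p) (by linarith [hp.2])).add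
    (hF.smul (c := 2 * p - 1) (by linarith [hp.1]))
  convert h using 1
  rw [noisyGate, smul_add, add_assoc, ← add_smul, ← Complex.ofReal_add]
  congr 4
  ring

theorem noiseThreshold_le {U : BiOp 2 2} {𝒩 : Set (BiOp 2 2 →ₗ[ℂ] BiOp 2 2)} {p₀ : ℝ}
    (hp₀ : 0 ≤ p₀) {F : BiOp 2 2 →ₗ[ℂ] BiOp 2 2} (hF : F ∈ 𝒩)
    (hsep : ∀ p ∈ Set.Icc p₀ 1, ∀ (n : ℕ) (ρ : QubitOp n), Reachable (noisyGate U F p) ρ →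
      IsFullySeparable ρ) : noiseThreshold U 𝒩 ≤ p₀ := by
  -- `0 ≤ p₀` covers an empty set of error probabilities, whose `sSup` is `0`.
  refine Real.sSup_le (fun p hp => ?_) hp₀
  by_contra! hlt
  obtain ⟨n, ρ, hρ, hent⟩ := hp.2 F hF
  exact hent (hsep p ⟨hlt.le, hp.1.2⟩ n ρ hρ)

/-! ### The controlled-NOT gate -/

theorem cnot_mem_unitaryGroup : cnot ∈ Matrix.unitaryGroup (Fin 2 × Fin 2) ℂ := by
  rw [Matrix.mem_unitaryGroup_iff]
  ext ⟨i, j⟩ ⟨k, l⟩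
  fin_cases i <;> fin_cases j <;> fin_cases k <;> fin_cases l <;>
    simp [cnot, Matrix.mul_apply, Fintype.sum_prod_type, Matrix.star_apply]

/-- The operators `(1 ± i Z) / 2`. -/
noncomputable def cnotLeft : Fin 2 → Matrix (Fin 2) (Fin 2) ℂ :=
  ![!![(1 + Complex.I) / 2, 0; 0, (1 - Complex.I) / 2],
    !![(1 - Complex.I) / 2, 0; 0, (1 + Complex.I) / 2]]

/-- The operators `((1 ∓ i) + (1 ± i) X) / (2 √2)`. -/
noncomputable def cnotRight : Fin 2 → Matrix (Fin 2) (Fin 2) ℂ :=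
  ![((Real.sqrt 2 / 4 : ℝ) : ℂ) • !![1 - Complex.I, 1 + Complex.I; 1 + Complex.I, 1 - Complex.I],
    ((Real.sqrt 2 / 4 : ℝ) : ℂ) • !![1 + Complex.I, 1 - Complex.I; 1 - Complex.I, 1 + Complex.I]]

/-- In `CNOT = |0⟩⟨0| ⊗ 1 + |1⟩⟨1| ⊗ X` the projections are not proportional to unitaries. Both
Schmidt coefficients equal `√2`, however, and this degeneracy allows a rotation of the two families
into multiples of unitaries. -/
theorem isUnitarySchmidt_cnot :
    IsUnitarySchmidt cnot (fun _ : Fin 2 => Real.sqrt 2) cnotLeft cnotRight := by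
  have hs : ((Real.sqrt 2 : ℝ) : ℂ) ^ 2 = 2 := by
    rw [← Complex.ofReal_pow, Real.sq_sqrt zero_le_two, Complex.ofReal_ofNat]
  refine { nonneg := fun _ => Real.sqrt_nonneg 2, orthonormal_left := ?_, orthonormal_right := ?_,
           decomp := ?_, unitary_left := ?_, unitary_right := ?_ }
  · intro j k
    fin_cases j <;> fin_cases k <;>
      simp [cnotLeft, Matrix.trace, Matrix.mul_apply, Fin.sum_univ_two, map_ofNat] <;>
      grind [Complex.I_sq]
  · intro j k
    fin_cases j <;> fin_cases k <;>
      simp [cnotRight, Matrix.trace, Matrix.mul_apply, Fin.sum_univ_two, map_ofNat] <;>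
      grind [Complex.I_sq]
  · ext ⟨i, j⟩ ⟨k, l⟩
    fin_cases i <;> fin_cases j <;> fin_cases k <;> fin_cases l <;>
      simp [cnot, cnotLeft, cnotRight, Matrix.sum_apply, Fin.sum_univ_two] <;>
      grind [Complex.I_sq]
  · intro j
    ext i k
    fin_cases j <;> fin_cases i <;> fin_cases k <;>
      simp [cnotLeft, Matrix.mul_apply, Fin.sum_univ_two, map_ofNat] <;>
      grind [Complex.I_sq]
  · intro j
    ext i k
    fin_cases j <;> fin_cases i <;> fin_cases k <;>
      simp [cnotRight, Matrix.mul_apply, Fin.sum_univ_two, map_ofNat] <;>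
      grind [Complex.I_sq]

theorem offDiagSum_cnot : offDiagSum (fun _ : Fin 2 => Real.sqrt 2) = 4 := by
  rw [offDiagSum_eq]
  simp only [Fin.sum_univ_two, Real.sq_sqrt zero_le_two]
  have := Real.sq_sqrt (zero_le_two (α := ℝ))
  nlinarith

theorem mainTheorem2 :
    (∀ (dA dB : ℕ), 0 < dA → 0 < dB →
      ∀ U : BiOp dA dB, U ∈ Matrix.unitaryGroup (Fin dA × Fin dB) ℂ →
      ∀ (r : ℕ) (u : Fin r → ℝ) (A : Fin r → Matrix (Fin dA) (Fin dA) ℂ)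
        (B : Fin r → Matrix (Fin dB) (Fin dB) ℂ), IsUnitarySchmidt U u A B →
      ∀ R : ℝ, R = (∑ j, u j) ^ 2 / ((dA : ℝ) * dB) - 1 →
        -- the values of the robustnesses
        (globalRobustness (conjOp U) = ENNReal.ofReal R ∧
          separableRobustness (conjOp U) = ENNReal.ofReal R ∧
          stateRobustness (gateState (conjOp U)) = ENNReal.ofReal R) ∧
        -- the minima in their definitions are attained (in particular `0 ≤ R`)
        (IsLeast {t | ∃ F, IsChannel F ∧ t ∈ gateMixing (conjOp U) F} R ∧
          IsLeast {t | ∃ F, IsChannel F ∧ IsSeparableOp F ∧ t ∈ gateMixing (conjOp U) F} R ∧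
          IsLeast {t | ∃ σ, IsSeparableState σ ∧ t ∈ stateMixing (gateState (conjOp U)) σ} R) ∧
        -- the explicit worst-case noise
        (0 < offDiagSum u →
          IsChannel (worstNoise u A B) ∧
          IsSeparableOp (worstNoise u A B) ∧
          IsLOCC (worstNoise u A B) ∧
          IsSeparableOp (conjOp U + (R : ℂ) • worstNoise u A B) ∧
          gateRelRobustness (conjOp U) (worstNoise u A B) = globalRobustness (conjOp U))) ∧
    -- the controlled-NOT gate
    (globalRobustness (conjOp cnot) = 1 ∧ separableRobustness (conjOp cnot) = 1 ∧
      (∃ (r : ℕ) (u : Fin r → ℝ) (A B : Fin r → Matrix (Fin 2) (Fin 2) ℂ),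
        IsUnitarySchmidt cnot u A B ∧ 0 < offDiagSum u ∧
        ∀ p ∈ Set.Icc (1 / 2 : ℝ) 1,
          IsSeparableOp (noisyGate cnot (worstNoise u A B) p) ∧
          ∀ (n : ℕ) (ρ : QubitOp n), Reachable (noisyGate cnot (worstNoise u A B) p) ρ →
            IsFullySeparable ρ) ∧
      noiseThreshold cnot {F | IsChannel F} ≤ 1 / 2 ∧
      noiseThreshold cnot {F | IsChannel F ∧ IsSeparableOp F} ≤ 1 / 2) := by

  refine ⟨fun dA dB hA hB U hU r u A B h R hR => h.robustness hA hB hU hR, ?_⟩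
  have hoff : 0 < offDiagSum fun _ : Fin 2 => Real.sqrt 2 := by
    rw [offDiagSum_cnot]
    norm_num
  -- `offDiagSum / (d_A d_B) = 4 / 4`.
  have hR : (1 : ℝ) = (∑ _j : Fin 2, Real.sqrt 2) ^ 2 / (((2 : ℕ) : ℝ) * ((2 : ℕ) : ℝ)) - 1 := by
    rw [isUnitarySchmidt_cnot.robustness_eq two_pos two_pos cnot_mem_unitaryGroup, offDiagSum_cnot]
    norm_num
  obtain ⟨⟨hg, hs, -⟩, -, hF⟩ :=
    isUnitarySchmidt_cnot.robustness two_pos two_pos cnot_mem_unitaryGroup hR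
  obtain ⟨hch, hsep, -, hadd, -⟩ := hF hoff
  rw [Complex.ofReal_one, one_smul] at hadd
  have hnoisy : ∀ p ∈ Set.Icc (1 / 2 : ℝ) 1, IsSeparableOp
      (noisyGate cnot (worstNoise (fun _ : Fin 2 => Real.sqrt 2) cnotLeft cnotRight) p) :=
    fun p hp => isSeparableOp_noisyGate hsep hadd hp
  have hreach : ∀ p ∈ Set.Icc (1 / 2 : ℝ) 1, ∀ (n : ℕ) (ρ : QubitOp n), Reachable
      (noisyGate cnot (worstNoise (fun _ : Fin 2 => Real.sqrt 2) cnotLeft cnotRight) p) ρ →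
      IsFullySeparable ρ := fun p hp n ρ hρ =>
    hρ.isFullySeparable (hnoisy p hp) (trace_noisyGate cnot_mem_unitaryGroup hch p)
  rw [ENNReal.ofReal_one] at hg hs
  exact ⟨hg, hs, ⟨2, _, cnotLeft, cnotRight, isUnitarySchmidt_cnot, hoff,
    fun p hp => ⟨hnoisy p hp, hreach p hp⟩⟩, noiseThreshold_le (by norm_num) hch hreach,
    noiseThreshold_le (by norm_num) ⟨hch, hsep⟩ hreach⟩
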